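/- Theorem. In the decision problem Obnoxious-Egal-CC one is given a metric space with distance $d$, a finite set $V$ of voters and a finite set $C$ of candidates in it, an integer $k \ge 1$ and a real number $t > 0$; the question is whether there is a committee $S \subseteq C$ with $|S| = k$ such that for every voter $v \in V$ the distance from $v$ to the point of $S$ farthest from $v$ is at least $t$. (This is the case $\lambda = 1$ of Obnox-Egal-Median-CS, in which for $1 \le \lambda \le k$ the distance from $v$ to its $\lambda$-th farthest point of $S$ has to be at least $t$.) Obnoxious-Egal-CC restricted to $V \cup C \subset \mathbb{R}^2$ with the Euclidean distance is solvable in polynomial time, in the following sense. There are a single real RAM program and a polynomial $p$ such that, for all finite sets $V, C \subset \mathbb{R}^2$ (each listed in any order, without repetition), every integer $k \ge 1$ and every real $t > 0$, the program, started with $|V|$, $|C|$, $k$, $t$ and the coordinates of the points in its memory, halts after at most $p(|V| + |C|)$ steps and answers correctly whether $(V, C, k, t)$ is a yes-instance. Moreover, if $t$ and all coordinates are rational and each number in the input has at most $B$ bits, then all numbers that occur in the memory during the computation are rational and have at most $p(|V| + |C| + B)$ bits, so that for rational inputs the running time is polynomial in the bit model as well. Here a real RAM has an unbounded array of cells for exact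 real numbers and an unbounded array of cells for natural numbers, which also serve as addresses. A step is one of the following: writing a constant (an integer into a real cell, a natural number into an integer cell); one of $+, -, \times, \div$ on real cells (division by $0$ is not allowed); addition or truncated subtraction on integer cells; copying a number of either kind with indirect addressing; and a comparison of two cells of the same kind, on which the program branches or repeats a loop. The number of bits of a rational number is the larger of the binary lengths of its reduced numerator and denominator. -/

import Mathlib

/-! ## Obnoxious egalitarian median committee selection -/

/-- `lamDist l x S` is the distance from `x` to the `l`-th farthest point of `S`, for
`1 ≤ l ≤ #S`: the distances from `x` to the points of `S` (with multiplicity) are sorted in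
decreasing order and the `l`-th entry is taken. -/
noncomputable def lamDist {X : Type*} [MetricSpace X] (l : ℕ) (x : X) (S : Finset X) : ℝ :=
  ((S.val.map (fun c => dist x c)).sort (fun a b => b ≤ a)).getD (l - 1) 0

/-- The question asked by Obnox-Egal-Median-CS with voters `V`, candidates `C`, committee size
`k`, parameter `l` (in the range `1 ≤ l ≤ k`) and threshold `t`. -/
def ObnoxEgalMedianCS {X : Type*} [MetricSpace X] (V C : Finset X) (k l : ℕ) (t : ℝ) : Prop :=
  ∃ S : Finset X, S ⊆ C ∧ S.card = k ∧ ∀ v ∈ V, t ≤ lamDist l v S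

/-- Obnoxious-Egal-CC is the case `l = 1`. -/
def ObnoxiousEgalCC {X : Type*} [MetricSpace X] (V C : Finset X) (k : ℕ) (t : ℝ) : Prop :=
  ObnoxEgalMedianCS V C k 1 t

/-- An instance of Obnoxious-Egal-CC in the Euclidean plane. The finite sets of voters and of
candidates are listed without repetition, in an arbitrary order (a point may be both a voter and
a candidate). -/
structure PlaneInstance where
  voters : List (EuclideanSpace ℝ (Fin 2))
  candidates : List (EuclideanSpace ℝ (Fin 2))
  voters_nodup : voters.Nodup
  candidates_nodup : candidates.Nodup
  k : ℕ
  k_pos : 1 ≤ k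
  t : ℝ
  t_pos : 0 < t

namespace PlaneInstance

def V (I : PlaneInstance) : Finset (EuclideanSpace ℝ (Fin 2)) :=
  ⟨(I.voters : Multiset _), Multiset.coe_nodup.2 I.voters_nodup⟩

def C (I : PlaneInstance) : Finset (EuclideanSpace ℝ (Fin 2)) :=
  ⟨(I.candidates : Multiset _), Multiset.coe_nodup.2 I.candidates_nodup⟩

def IsYes (I : PlaneInstance) : Prop := ObnoxiousEgalCC I.V I.C I.k I.t

def numPoints (I : PlaneInstance) : ℕ := I.voters.length + I.candidates.length

end PlaneInstance

/-! ## The real RAM -/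

namespace RealRAM

/-- The memory of a real RAM: an unbounded array `W` of integer cells (natural numbers, which
also serve as addresses) and an unbounded array `R` of cells that hold exact real numbers. -/
structure State where
  W : ℕ → ℕ
  R : ℕ → ℝ

def State.setW (s : State) (i n : ℕ) : State := { s with W := Function.update s.W i n }

def State.setR (s : State) (i : ℕ) (x : ℝ) : State := { s with R := Function.update s.R i x }

/-- The instructions; each has unit cost. The arithmetic on integer cells is limited to addition
and truncated subtraction; the arithmetic on real cells is that of an ordered field. There is no
rounding and no conversion between the two kinds of cells, and the constants in a program are
natural numbers and integers. -/
inductive Instr where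
  | constW (d n : ℕ)
  | addW (d a b : ℕ)
  | subW (d a b : ℕ)
  | loadW (d a : ℕ)
  | storeW (a b : ℕ)
  | constR (d : ℕ) (z : ℤ)
  | addR (d a b : ℕ)
  | subR (d a b : ℕ)
  | mulR (d a b : ℕ)
  | divR (d a b : ℕ)
  | loadR (d a : ℕ)
  | storeR (a b : ℕ)

/-- The effect of an instruction. A division by zero has no result: the machine is stuck. -/
noncomputable def Instr.run : Instr → State → Option State
  | constW d n, s => some (s.setW d n)
  | addW d a b, s => some (s.setW d (s.W a + s.W b))
  | subW d a b, s => some (s.setW d (s.W a - s.W b))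
  | loadW d a, s => some (s.setW d (s.W (s.W a)))
  | storeW a b, s => some (s.setW (s.W a) (s.W b))
  | constR d z, s => some (s.setR d (z : ℝ))
  | addR d a b, s => some (s.setR d (s.R a + s.R b))
  | subR d a b, s => some (s.setR d (s.R a - s.R b))
  | mulR d a b, s => some (s.setR d (s.R a * s.R b))
  | divR d a b, s => if s.R b = 0 then none else some (s.setR d (s.R a / s.R b))
  | loadR d a, s => some (s.setR d (s.R (s.W a)))
  | storeR a b, s => some (s.setR (s.W a) (s.R b))

/-- The tests on which a program can branch: comparisons of two cells. -/
inductive Test where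
  | ltW (a b : ℕ)
  | leW (a b : ℕ)
  | ltR (a b : ℕ)
  | leR (a b : ℕ)

def Test.Holds : Test → State → Prop
  | ltW a b, s => s.W a < s.W b
  | leW a b, s => s.W a ≤ s.W b
  | ltR a b, s => s.R a < s.R b
  | leR a b, s => s.R a ≤ s.R b

/-- Programs. -/
inductive Program where
  | instr (i : Instr)
  | seq (P P' : Program)
  | branch (b : Test) (P P' : Program)
  | loop (b : Test) (P : Program)

/-- `Exec Q P s T s'`: started in memory `s`, the program `P` halts after `T` steps (instructions
and evaluations of tests) with memory `s'`, and the memory satisfies `Q` after every instruction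
on the way. `loop b P` repeats `P` as long as `b` holds. -/
inductive Exec (Q : State → Prop) : Program → State → ℕ → State → Prop
  | instr {i : Instr} {s s' : State} (h : i.run s = some s') (hQ : Q s') :
      Exec Q (.instr i) s 1 s'
  | seq {P P' : Program} {s s' s'' : State} {m n : ℕ} (h : Exec Q P s m s')
      (h' : Exec Q P' s' n s'') : Exec Q (.seq P P') s (m + n) s''
  | branch_true {b : Test} {P P' : Program} {s s' : State} {m : ℕ} (hb : b.Holds s)
      (h : Exec Q P s m s') : Exec Q (.branch b P P') s (m + 1) s'
  | branch_false {b : Test} {P P' : Program} {s s' : State} {m : ℕ} (hb : ¬ b.Holds s)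
      (h : Exec Q P' s m s') : Exec Q (.branch b P P') s (m + 1) s'
  | loop_true {b : Test} {P : Program} {s s' s'' : State} {m n : ℕ} (hb : b.Holds s)
      (h : Exec Q P s m s') (h' : Exec Q (.loop b P) s' n s'') :
      Exec Q (.loop b P) s (m + n + 1) s''
  | loop_false {b : Test} {P : Program} {s : State} (hb : ¬ b.Holds s) :
      Exec Q (.loop b P) s 1 s

/-- Every number in the memory is rational and has a binary representation of at most `B` bits
(for a rational number, its reduced numerator and denominator are each of at most `B` bits). -/
def State.BitsLE (B : ℕ) (s : State) : Prop :=
  (∀ i, (s.W i).size ≤ B) ∧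
  ∀ i, ∃ q : ℚ, s.R i = (q : ℝ) ∧ q.num.natAbs.size ≤ B ∧ q.den.size ≤ B

/-- The problem with yes-instances `Yes`, whose instance `a` is given to the machine as the
initial memory `input a` and has `size a` input objects, is decided in polynomial time: there are
one program and one polynomial `p` such that on every instance `a` the program halts after at most
`p (size a)` steps with the answer (`1` for yes and `0` for no) in the integer cell `0`; moreover,
on input numbers that are rational and of at most `B` bits each, all numbers that ever occur in
the memory are rational and of at most `p (size a + B)` bits (so the polynomial bound on the
number of unit-cost steps is a polynomial bound on the number of bit operations, too). -/
def DecidesInPolyTime {α : Type} (input : α → State) (size : α → ℕ) (Yes : α → Prop) : Prop :=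
  ∃ (P : Program) (p : Polynomial ℕ), ∀ a : α, ∃ (T : ℕ) (s' : State),
    Exec (fun s => ∀ B : ℕ, (input a).BitsLE B → s.BitsLE (p.eval (size a + B)))
      P (input a) T s' ∧
    T ≤ p.eval (size a) ∧
    (Yes a → s'.W 0 = 1) ∧ (¬ Yes a → s'.W 0 = 0)

end RealRAM

/-- The initial memory for an instance: the integer cells `0, 1, 2` hold the numbers of voters and
of candidates and `k`; the real cells hold `t`, then the two coordinates of each voter, then those
of each candidate. All other cells are zero. -/
noncomputable def PlaneInstance.encode (I : PlaneInstance) : RealRAM.State where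
  W i := [I.voters.length, I.candidates.length, I.k].getD i 0
  R i := (I.t :: (I.voters ++ I.candidates).flatMap (fun x => [x 0, x 1])).getD i 0

/-!
Call a voter covered by a candidate if their distance is at least `t`. The instance is a
yes-instance if and only if `k ≤ |C|` and at most `k` candidates cover all voters, since a cover
can be enlarged.

In a minimal cover every member `c` has a voter `p` that no other member covers. The algorithm
guesses `c` and `p`. The voters that `c` does not cover lie in the open disc of radius `t` about
`c`, hence, as seen from `p`, in an open half-plane, where they are ordered by angle around `p`;
their ranks in this order are found by counting. The other members of the cover have `p` in their
open discs, and the point is that the sets of voters they cover then do not alternate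
(`no_alternation`): if `b` covers `x` and `z`, but not `y` between them, then no `d` covers `y`
without covering `x` or `z`. Indeed, the line through `x` and `z` meets the disc about `b` only
between `x` and `z`, and `p` and `y` lie in this disc on opposite sides of the line. So the
segment from `b` to one of them crosses the line between `x` and `z`. In the case of `y`, the
bisector of `b` and `d` has `b` and `y` on one side and `x` and `z` on the other; in the case of
`p` the same holds for the bisector of `b` and `c`. This uses that all radii are equal.

For families without alternations the greedy algorithm is optimal: repeatedly choose the candidate
whose first failure, among the voters not yet covered, has the largest rank, and go on from there
(`exists_erase_cover`, `accepts_of_cover`). Conversely a success of the greedy algorithm yields a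
cover, no matter what `c` and `p` are (`Accepts.exists_cover`).

The program is a nest of counting loops (`mainProg`), verified with a total correctness calculus
that keeps track of time (`Run`). An integer cell gains at most one bit per step (`Exec.size_le`).
Real numbers enter the computation only through the tests `far` and `leftTurn`, polynomials of
degree two in the input numbers; each register holds a value of a fixed algebraic depth, which
bounds its bit length (`LevelBits`).
-/

namespace RealRAM

/-! ### Bit lengths -/

/-- `x` is a rational number whose reduced numerator and denominator have at most `n` bits. -/
def RBits (n : ℕ) (x : ℝ) : Prop :=
  ∃ q : ℚ, x = (q : ℝ) ∧ q.num.natAbs.size ≤ n ∧ q.den.size ≤ n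

theorem RBits.mono {m n : ℕ} {x : ℝ} (h : RBits m x) (hmn : m ≤ n) : RBits n x := by
  obtain ⟨q, hq, h1, h2⟩ := h
  exact ⟨q, hq, h1.trans hmn, h2.trans hmn⟩

/-- A fraction need not be reduced for its entries to bound the bit length. -/
theorem RBits.of_div {n : ℕ} {a b : ℤ} (hb : b ≠ 0) (ha' : a.natAbs.size ≤ n)
    (hb' : b.natAbs.size ≤ n) : RBits n ((a : ℝ) / b) := by
  refine ⟨(a : ℚ) / b, by push_cast; rfl, ?_, ?_⟩
  · refine (Nat.size_le_size ?_).trans ha'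
    rcases eq_or_ne a 0 with rfl | h0
    · simp
    · rw [← Rat.divInt_eq_div]
      exact Nat.le_of_dvd (Int.natAbs_pos.2 h0) (Int.natAbs_dvd_natAbs.2 (Rat.num_dvd a hb))
  · refine (Nat.size_le_size ?_).trans hb'
    rw [← Rat.divInt_eq_div]
    have := Rat.den_dvd a b
    exact Nat.le_of_dvd (Int.natAbs_pos.2 hb) (Int.natCast_dvd.1 this)

theorem RBits.exists_div {n : ℕ} {x : ℝ} (h : RBits n x) :
    ∃ a b : ℤ, b ≠ 0 ∧ x = (a : ℝ) / b ∧ a.natAbs < 2 ^ n ∧ b.natAbs < 2 ^ n := by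
  obtain ⟨q, rfl, h1, h2⟩ := h
  refine ⟨q.num, q.den, by exact_mod_cast q.den_nz, ?_, Nat.size_le.1 h1, ?_⟩
  · rw [Int.cast_natCast]; exact Rat.cast_def q
  · simpa using Nat.size_le.1 h2

theorem RBits.mul {m n : ℕ} {x y : ℝ} (hx : RBits m x) (hy : RBits n y) :
    RBits (m + n) (x * y) := by
  obtain ⟨a, b, hb, rfl, ha1, hb1⟩ := hx.exists_div
  obtain ⟨c, d, hd, rfl, hc1, hd1⟩ := hy.exists_div
  rw [div_mul_div_comm]
  have := RBits.of_div (n := m + n) (a := a * c) (b := b * d) (mul_ne_zero hb hd)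
    (by rw [Nat.size_le, Int.natAbs_mul, pow_add]; gcongr)
    (by rw [Nat.size_le, Int.natAbs_mul, pow_add]; gcongr)
  exact_mod_cast this

theorem RBits.neg {n : ℕ} {x : ℝ} (hx : RBits n x) : RBits n (-x) := by
  obtain ⟨q, rfl, h1, h2⟩ := hx
  exact ⟨-q, by push_cast; rfl, by simpa using h1, by simpa using h2⟩

theorem RBits.add {m n : ℕ} {x y : ℝ} (hx : RBits m x) (hy : RBits n y) :
    RBits (m + n + 1) (x + y) := by
  obtain ⟨a, b, hb, rfl, ha1, hb1⟩ := hx.exists_div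
  obtain ⟨c, d, hd, rfl, hc1, hd1⟩ := hy.exists_div
  have hb' : (b : ℝ) ≠ 0 := by exact_mod_cast hb
  have hd' : (d : ℝ) ≠ 0 := by exact_mod_cast hd
  rw [div_add_div _ _ hb' hd']
  have := RBits.of_div (n := m + n + 1) (a := a * d + b * c) (b := b * d) (mul_ne_zero hb hd)
    (by
      rw [Nat.size_le]
      have h1 : a.natAbs * d.natAbs < 2 ^ m * 2 ^ n := by gcongr
      have h2 : b.natAbs * c.natAbs < 2 ^ m * 2 ^ n := by gcongr
      have h3 := Int.natAbs_add_le (a * d) (b * c)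
      rw [Int.natAbs_mul, Int.natAbs_mul] at h3
      rw [pow_succ, pow_add]
      omega)
    (by
      rw [Nat.size_le, Int.natAbs_mul]
      have h1 : b.natAbs * d.natAbs < 2 ^ m * 2 ^ n := by gcongr
      rw [pow_succ, pow_add]
      omega)
  exact_mod_cast this

theorem RBits.sub {m n : ℕ} {x y : ℝ} (hx : RBits m x) (hy : RBits n y) :
    RBits (m + n + 1) (x - y) := by
  rw [sub_eq_add_neg]; exact hx.add hy.neg

theorem natSize_add_le {a b n : ℕ} (ha : a.size ≤ n) (hb : b.size ≤ n) :
    (a + b).size ≤ n + 1 := by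
  rw [Nat.size_le] at *
  rw [pow_succ]; omega

/-! ### Executions and their resource bounds -/

theorem Exec.mono {Q Q' : State → Prop} (h : ∀ s, Q s → Q' s) {P : Program} {s s' : State}
    {T : ℕ} (e : Exec Q P s T s') : Exec Q' P s T s' := by
  induction e with
  | instr h1 h2 => exact .instr h1 (h _ h2)
  | seq _ _ ih ih' => exact .seq ih ih'
  | branch_true hb _ ih => exact .branch_true hb ih
  | branch_false hb _ ih => exact .branch_false hb ih
  | loop_true hb _ _ ih ih' => exact .loop_true hb ih ih'
  | loop_false hb => exact .loop_false hb

/-- The largest bit length of an integer constant that a program writes. -/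
def Program.constBits : Program → ℕ
  | .instr (.constW _ n) => n.size
  | .instr _ => 0
  | .seq P P' => max P.constBits P'.constBits
  | .branch _ P P' => max P.constBits P'.constBits
  | .loop _ P => P.constBits

theorem Instr.run_size {i : Instr} {s s' : State} (h : i.run s = some s') {B : ℕ}
    (hc : (Program.instr i).constBits ≤ B) (hs : ∀ j, (s.W j).size ≤ B) (j : ℕ) :
    (s'.W j).size ≤ B + 1 := by
  have key : ∀ d x : ℕ, x.size ≤ B + 1 → ((s.setW d x).W j).size ≤ B + 1 := by
    intro d x hx
    simp only [State.setW, Function.update_apply]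
    split_ifs
    · exact hx
    · exact (hs j).trans (Nat.le_succ B)
  have le1 : ∀ {x : ℕ}, x ≤ B → x ≤ B + 1 := fun h => h.trans (Nat.le_succ B)
  cases i with
  | divR d a b =>
    simp only [Instr.run] at h
    split_ifs at h
    cases h
    exact le1 (hs j)
  | constW d n => cases h; exact key _ _ (le1 hc)
  | addW d a b => cases h; exact key _ _ (natSize_add_le (hs a) (hs b))
  | subW d a b => cases h; exact key _ _ (le1 ((Nat.size_le_size (Nat.sub_le _ _)).trans (hs a)))
  | loadW d a => cases h; exact key _ _ (le1 (hs _))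
  | storeW a b => cases h; exact key _ _ (le1 (hs _))
  | _ => cases h; exact le1 (hs j)

/-- Integer cells gain at most one bit per step. So, for integer cells, the bound on the bit
lengths follows from the bound on the number of steps. -/
theorem Exec.size_le {Q : State → Prop} {P : Program} {s s' : State} {T : ℕ}
    (e : Exec Q P s T s') : ∀ B, P.constBits ≤ B → (∀ i, (s.W i).size ≤ B) →
      Exec (fun s => Q s ∧ ∀ i, (s.W i).size ≤ B + T) P s T s' ∧
        ∀ i, (s'.W i).size ≤ B + T := by
  induction e with
  | instr h1 h2 =>
    intro B hc hs
    exact ⟨.instr h1 ⟨h2, Instr.run_size h1 hc hs⟩, Instr.run_size h1 hc hs⟩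
  | @seq _ _ _ _ _ m n _ _ ih ih' =>
    intro B hc hs
    obtain ⟨e1, h1⟩ := ih B ((le_max_left _ _).trans hc) hs
    obtain ⟨e2, h2⟩ := ih' (B + m) (((le_max_right _ _).trans hc).trans (Nat.le_add_right _ _)) h1
    rw [add_assoc] at h2 e2
    exact ⟨.seq (e1.mono fun s h => ⟨h.1, fun i => (h.2 i).trans (by omega)⟩) e2, h2⟩
  | branch_true hb _ ih =>
    intro B hc hs
    obtain ⟨e1, h1⟩ := ih B ((le_max_left _ _).trans hc) hs
    exact ⟨.branch_true hb (e1.mono fun s h => ⟨h.1, fun i => (h.2 i).trans (by omega)⟩),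
      fun i => (h1 i).trans (by omega)⟩
  | branch_false hb _ ih =>
    intro B hc hs
    obtain ⟨e1, h1⟩ := ih B ((le_max_right _ _).trans hc) hs
    exact ⟨.branch_false hb (e1.mono fun s h => ⟨h.1, fun i => (h.2 i).trans (by omega)⟩),
      fun i => (h1 i).trans (by omega)⟩
  | @loop_true _ _ _ _ _ m n hb _ _ ih ih' =>
    intro B hc hs
    obtain ⟨e1, h1⟩ := ih B hc hs
    obtain ⟨e2, h2⟩ := ih' (B + m) (hc.trans (Nat.le_add_right _ _)) h1
    exact ⟨.loop_true hb (e1.mono fun s h => ⟨h.1, fun i => (h.2 i).trans (by omega)⟩)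
      (e2.mono fun s h => ⟨h.1, fun i => (h.2 i).trans (by omega)⟩),
      fun i => (h2 i).trans (by omega)⟩
  | loop_false hb =>
    intro B hc hs
    exact ⟨.loop_false hb, fun i => (hs i).trans (by omega)⟩

/-! ### Total correctness with a time bound -/

/-- Started in `s`, the program `P` halts within `T` steps in a memory that satisfies `post`,
and `Q` holds after every instruction on the way. -/
def Run (Q : State → Prop) (P : Program) (T : ℕ) (s : State) (post : State → Prop) : Prop :=
  ∃ T' ≤ T, ∃ s', Exec Q P s T' s' ∧ post s'

section Rules

variable {Q : State → Prop} {P P' : Program} {T T' : ℕ} {s : State} {post post' : State → Prop}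

theorem Run.mono (h : Run Q P T s post) (hT : T ≤ T') (hp : ∀ s', post s' → post' s') :
    Run Q P T' s post' := by
  obtain ⟨t, ht, s', e, h'⟩ := h
  exact ⟨t, ht.trans hT, s', e, hp _ h'⟩

theorem Run.instr {i : Instr} {s' : State} (h : i.run s = some s') (hQ : Q s') (hp : post s') :
    Run Q (.instr i) 1 s post :=
  ⟨1, le_rfl, s', .instr h hQ, hp⟩

theorem Run.seq {mid : State → Prop} (h : Run Q P T s mid)
    (h' : ∀ s', mid s' → Run Q P' T' s' post) : Run Q (.seq P P') (T + T') s post := by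
  obtain ⟨t, ht, s1, e, hm⟩ := h
  obtain ⟨t', ht', s2, e', hp⟩ := h' _ hm
  exact ⟨t + t', add_le_add ht ht', s2, .seq e e', hp⟩

/-- An instruction followed by a program. -/
theorem Run.step {i : Instr} {s' : State} (h : i.run s = some s') (hQ : Q s')
    (h' : Run Q P T s' post) : Run Q (.seq (.instr i) P) (T + 1) s post := by
  rw [add_comm]
  exact (Run.instr (post := fun x => x = s') h hQ rfl).seq (by rintro _ rfl; exact h')

theorem Run.branch {b : Test} (h : b.Holds s → Run Q P T s post)
    (h' : ¬ b.Holds s → Run Q P' T s post) : Run Q (.branch b P P') (T + 1) s post := by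
  by_cases hb : b.Holds s
  · obtain ⟨t, ht, s', e, hp⟩ := h hb
    exact ⟨t + 1, by omega, s', .branch_true hb e, hp⟩
  · obtain ⟨t, ht, s', e, hp⟩ := h' hb
    exact ⟨t + 1, by omega, s', .branch_false hb e, hp⟩

/-- The loop in which the integer cell `i` runs up to the value of the cell `b`. The cell `3`
holds the number one. -/
def upTo (i b : ℕ) (P : Program) : Program :=
  .loop (.ltW i b) (.seq P (.instr (.addW i i 3)))

/-- The invariant of the loop `upTo` is indexed by the value of the counter. -/
theorem Run.upTo {i b n : ℕ} (Inv : ℕ → State → Prop)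
    (hi : ∀ j s, Inv j s → s.W i = j ∧ s.W b = n)
    (hbody : ∀ j s, j < n → Inv j s → Run Q P T s
      fun s' => s'.W i = j ∧ s'.W 3 = 1 ∧ Q (s'.setW i (j + 1)) ∧ Inv (j + 1) (s'.setW i (j + 1)))
    {j : ℕ} (hj : j ≤ n) (h0 : Inv j s) :
    Run Q (upTo i b P) ((n - j) * (T + 2) + 1) s (Inv n) := by
  induction hd : n - j generalizing j s with
  | zero =>
    have : j = n := by omega
    subst this
    refine ⟨1, by omega, s, .loop_false ?_, h0⟩
    simp only [Test.Holds, hi _ _ h0]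
    omega
  | succ d ih =>
    obtain ⟨t1, ht1, s1, e1, h1, h1', hq, hinv⟩ := hbody j s (by omega) h0
    obtain ⟨t2, ht2, s2, e2, h2⟩ := ih (j := j + 1) (by omega) hinv (by omega)
    refine ⟨t1 + 1 + t2 + 1, ?_, s2, .loop_true ?_ (.seq e1 (.instr ?_ hq)) e2, h2⟩
    · rw [Nat.succ_mul]; omega
    · simp only [Test.Holds, hi _ _ h0]
      omega
    · simp [Instr.run, h1, h1']

end Rules

/-! ### The greedy algorithm as a function -/

section Greedy

open Classical in
/-- The number of voters `u` not covered by `c` that precede `v` in the order `before`. -/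
noncomputable def rank (n : ℕ) (cov : ℕ → ℕ → Prop) (before : ℕ → ℕ → ℕ → Prop)
    (c p v : ℕ) : ℕ :=
  Nat.count (fun u => ¬ cov c u ∧ before p u v) n

open Classical in
/-- Among the voters `v < j` that neither `c` nor `e` covers and whose rank is at least `τ`, the
least rank; it is `n` if there are none. -/
noncomputable def failTo (n : ℕ) (cov : ℕ → ℕ → Prop) (before : ℕ → ℕ → ℕ → Prop)
    (c p e τ : ℕ) : ℕ → ℕ
  | 0 => n
  | v + 1 =>
    if ¬ cov c v ∧ ¬ cov e v ∧ τ ≤ rank n cov before c p v ∧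
        rank n cov before c p v < failTo n cov before c p e τ v
    then rank n cov before c p v else failTo n cov before c p e τ v

/-- The best value of `failTo` that a candidate achieves. The candidates have the indices from `n`
to `N - 1`. -/
noncomputable def nextThreshold (n N : ℕ) (cov : ℕ → ℕ → Prop) (before : ℕ → ℕ → ℕ → Prop)
    (c p τ : ℕ) : ℕ :=
  (Finset.Ico n N).sup fun e => failTo n cov before c p e τ n

/-- The threshold after `j` greedy choices of a candidate: every voter not covered by `c` and of
smaller rank is covered by one of the chosen candidates. -/
noncomputable def threshold (n N : ℕ) (cov : ℕ → ℕ → Prop) (before : ℕ → ℕ → ℕ → Prop)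
    (c p : ℕ) : ℕ → ℕ
  | 0 => 0
  | j + 1 => nextThreshold n N cov before c p (threshold n N cov before c p j)

/-- Together with `c`, the greedy choice of `k - 1` candidates covers all voters. -/
def Accepts (n N k : ℕ) (cov : ℕ → ℕ → Prop) (before : ℕ → ℕ → ℕ → Prop) (c p : ℕ) : Prop :=
  n ≤ failTo n cov before c p c (threshold n N cov before c p (k - 1)) n

end Greedy

/-! ### The program -/

/-! The integer cells are used as follows: `0`, `1`, `2` hold the numbers `n` of voters, `m` of
candidates, and `k`; `3` holds one; `4` the address of the coordinates; `5` the number `n + m` of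
points; `6` zero; `7` the answer; `8` and `9` the numbers of `c` and `p`; `10` counts greedy
choices; `11` the current threshold; `12` the next one; `13` a candidate; `14` the value of
`failTo`; `15` a voter; `16` its rank; `17` a voter; `18` serves as a dummy; `19` holds addresses.
A subroutine that returns its result in cell `d` leaves the cells below `d` unchanged. Points are
numbered from `0`, the voters first. -/

/-- The points numbered `a` and `b` are at distance at least `t`, where `ρ` lists `t` and the
coordinates of the points. -/
def far (ρ : ℕ → ℝ) (a b : ℕ) : Prop :=
  ρ 0 * ρ 0 ≤ (ρ (2 * a + 1) - ρ (2 * b + 1)) * (ρ (2 * a + 1) - ρ (2 * b + 1)) +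
    (ρ (2 * a + 2) - ρ (2 * b + 2)) * (ρ (2 * a + 2) - ρ (2 * b + 2))

/-- The points numbered `o`, `a`, `b` make a strict left turn, that is, `b - o` is
counterclockwise of `a - o`. -/
def leftTurn (ρ : ℕ → ℝ) (o a b : ℕ) : Prop :=
  (ρ (2 * a + 2) - ρ (2 * o + 2)) * (ρ (2 * b + 1) - ρ (2 * o + 1)) <
    (ρ (2 * a + 1) - ρ (2 * o + 1)) * (ρ (2 * b + 2) - ρ (2 * o + 2))

/-- Load the coordinates of the point whose number is in the integer cell `i` into the real cells
`x` and `y`, then continue with `P`. The cell `4` holds the address of the first coordinate of the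
point number `0`. -/
def loadPoint (x y i : ℕ) (P : Program) : Program :=
  .seq (.instr (.addW 19 i i)) <| .seq (.instr (.addW 19 19 4)) <|
  .seq (.instr (.loadR x 19)) <| .seq (.instr (.addW 19 19 3)) <| .seq (.instr (.loadR y 19)) P

/-- Branch on whether the points with numbers in the cells `i` and `j` are far apart. The real
cell `0` holds the square of `t`. -/
def testFar (i j : ℕ) (P P' : Program) : Program :=
  loadPoint 1 2 i <| loadPoint 3 4 j <|
  .seq (.instr (.subR 7 1 3)) <| .seq (.instr (.subR 8 2 4)) <|
  .seq (.instr (.mulR 11 7 7)) <| .seq (.instr (.mulR 12 8 8)) <|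
  .seq (.instr (.addR 13 11 12)) <| .branch (.leR 0 13) P P'

/-- Branch on whether the points with numbers in the cells `o`, `i` and `j` make a left turn. -/
def testTurn (o i j : ℕ) (P P' : Program) : Program :=
  loadPoint 1 2 o <| loadPoint 3 4 i <| loadPoint 5 6 j <|
  .seq (.instr (.subR 7 3 1)) <| .seq (.instr (.subR 8 4 2)) <|
  .seq (.instr (.subR 9 5 1)) <| .seq (.instr (.subR 10 6 2)) <|
  .seq (.instr (.mulR 11 7 10)) <| .seq (.instr (.mulR 12 8 9)) <| .branch (.ltR 12 11) P P'

/-- An instruction without effect on the cells in use. -/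
def skip : Program := .instr (.constW 18 0)

/-- Writes `rank` to the cell `16`. The voter is in the cell `15`, `c` in `8`, `p` in `9`. -/
def rankProg : Program :=
  .seq (.instr (.constW 16 0)) <| .seq (.instr (.constW 17 0)) <|
  upTo 17 0 (testFar 8 17 skip (testTurn 9 17 15 (.instr (.addW 16 16 3)) skip))

/-- Writes `failTo` to the cell `14`. The candidate is in the cell `13`, the threshold in `11`. -/
def failProg : Program :=
  .seq (.instr (.addW 14 0 6)) <| .seq (.instr (.constW 15 0)) <|
  upTo 15 0 (testFar 8 15 skip (testFar 13 15 skip (.seq rankProg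
    (.branch (.leW 11 16) (.branch (.ltW 16 14) (.instr (.addW 14 16 6)) skip) skip))))

/-- Writes `nextThreshold` to the cell `12`. -/
def roundProg : Program :=
  .seq (.instr (.constW 12 0)) <| .seq (.instr (.addW 13 0 6)) <|
  upTo 13 5 (.seq failProg (.branch (.ltW 12 14) (.instr (.addW 12 14 6)) skip))

/-- Writes `1` to the cell `7` if the greedy choice succeeds for `c` and `p`. -/
def trialProg : Program :=
  .seq (.instr (.constW 11 0)) <| .seq (.instr (.constW 10 1)) <|
  .seq (upTo 10 2 (.seq roundProg (.instr (.addW 11 12 6)))) <|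
  .seq (.instr (.addW 13 8 6)) <| .seq failProg <|
  .branch (.leW 0 14) (.instr (.constW 7 1)) skip

/-- Tries all candidates `c` and all voters `p`. -/
def searchProg : Program :=
  .seq (.instr (.constW 7 0)) <| .seq (.instr (.addW 8 0 6)) <|
  upTo 8 5 (.seq (.instr (.constW 9 0)) (upTo 9 0 trialProg))

/-- Moves the coordinates away from the cells that serve as registers, and squares `t`. -/
def initProg : Program :=
  .seq (.instr (.constW 3 1)) <| .seq (.instr (.addW 5 0 1)) <|
  .seq (.instr (.addW 8 5 5)) <| .seq (.instr (.constW 9 14)) <|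
  .seq (.instr (.addW 4 8 9)) <| .seq (.instr (.addW 9 4 6)) <|
  .seq (.instr (.addW 8 8 3)) <| .seq (.instr (.constW 10 1)) <|
  .seq (upTo 10 8 (.seq (.instr (.loadR 1 10)) <| .seq (.instr (.storeR 9 1)) <|
    (.instr (.addW 9 9 3)))) <|
  .instr (.mulR 0 0 0)

/-- The decision program: `k ≤ m` is necessary, and sufficient if there are no voters. -/
def mainProg : Program :=
  .seq initProg <| .branch (.ltW 1 2) (.instr (.constW 0 0)) <|
  .branch (.ltW 0 3) (.instr (.constW 0 1)) <| .seq searchProg (.instr (.addW 0 7 6))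

/-! ### The memory during the computation -/

/-- The real cell `j` never holds a number of more than `level j * (B + 1)` bits if the input
numbers have at most `B` bits. The cell `0` holds the square of `t`, the cells `1` to `6` hold
coordinates, `7` to `10` differences of them, `11` and `12` products of two differences, and `13` a
squared distance; the cells from `14` hold numbers of the input. The level of the result of an
operation exceeds the sum of the levels of its operands. -/
def level (j : ℕ) : ℕ := [3, 1, 1, 1, 1, 1, 1, 3, 3, 3, 3, 7, 7, 15].getD j 1

/-- The bound on the real cells by their levels. -/
def LevelBits (ρ : ℕ → ℝ) (s : State) : Prop :=
  ∀ B, (∀ i, RBits B (ρ i)) → ∀ j, RBits (level j * (B + 1)) (s.R j)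

/-- The memory after the initialization, for `n` voters, `m` candidates, committee size `k` and
the initial real cells `ρ`. It puts no condition on the integer cells from `7` and on the contents
of the real cells `1` to `13`, up to their bit lengths. -/
structure Ready (n m k : ℕ) (ρ : ℕ → ℝ) (s : State) : Prop where
  bits : LevelBits ρ s
  n_eq : s.W 0 = n
  m_eq : s.W 1 = m
  k_eq : s.W 2 = k
  one_eq : s.W 3 = 1
  base_le : 14 ≤ s.W 4
  size_eq : s.W 5 = n + m
  zero_eq : s.W 6 = 0
  sq_eq : s.R 0 = ρ 0 * ρ 0
  coord_eq : ∀ i < 2 * (n + m), s.R (s.W 4 + i) = ρ (i + 1)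

/-- The integer cells below `d` agree. -/
def Same (d : ℕ) (s s' : State) : Prop := ∀ i < d, s'.W i = s.W i

theorem Same.mono {d d' : ℕ} {s s' : State} (h : Same d s s') (hd : d' ≤ d) : Same d' s s' :=
  fun i hi => h i (hi.trans_le hd)

theorem Same.trans {d : ℕ} {s s' s'' : State} (h : Same d s s') (h' : Same d s' s'') :
    Same d s s'' := fun i hi => (h' i hi).trans (h i hi)

theorem Same.setW {d i x : ℕ} {s s' : State} (h : Same d s s') (hi : d ≤ i) :
    Same d s (s'.setW i x) := by
  intro j hj
  simp only [State.setW]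
  rw [Function.update_of_ne (by omega)]
  exact h j hj

theorem Same.refl (d : ℕ) (s : State) : Same d s s := fun _ _ => rfl

theorem State.setW_W (s : State) (i x j : ℕ) : (s.setW i x).W j = if j = i then x else s.W j := by
  simp [State.setW, Function.update_apply]

theorem State.setR_R (s : State) (i : ℕ) (x : ℝ) (j : ℕ) :
    (s.setR i x).R j = if j = i then x else s.R j := by
  simp [State.setR, Function.update_apply]

theorem State.setW_R (s : State) (i x : ℕ) : (s.setW i x).R = s.R := rfl

theorem State.setR_W (s : State) (i : ℕ) (x : ℝ) : (s.setR i x).W = s.W := rfl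

section Ready

variable {n m k : ℕ} {ρ : ℕ → ℝ} {s : State}

theorem Ready.setW (h : Ready n m k ρ s) {i x : ℕ} (hi : 7 ≤ i) : Ready n m k ρ (s.setW i x) := by
  obtain ⟨h0, h1, h2, h3, h4, h5, h6, h7, h8, h9⟩ := h
  have h : ∀ j < 7, (s.setW i x).W j = s.W j := fun j hj => by
    rw [State.setW_W, if_neg (by omega)]
  constructor <;> try rw [h _ (by norm_num)]
  all_goals assumption

theorem Ready.setR (h : Ready n m k ρ s) {i : ℕ} {x : ℝ} (hi : i ∈ Set.Icc 1 13)
    (hx : ∀ B, (∀ i, RBits B (ρ i)) → RBits (level i * (B + 1)) x) :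
    Ready n m k ρ (s.setR i x) := by
  obtain ⟨h0, h1, h2, h3, h4, h5, h6, h7, h8, h9⟩ := h
  obtain ⟨hi1, hi2⟩ := hi
  refine ⟨fun B hB j => ?_, h1, h2, h3, h4, h5, h6, h7, ?_, fun j hj => ?_⟩
  · rw [State.setR_R]
    split_ifs with h
    · subst h; exact hx B hB
    · exact h0 B hB j
  · rw [State.setR_R, if_neg (by omega), h8]
  · rw [State.setR_R, State.setR_W, if_neg (by omega), h9 j hj]

theorem Ready.subR (h : Ready n m k ρ s) {d a b : ℕ} (hd : d ∈ Set.Icc 1 13)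
    (hl : level a + level b + 1 ≤ level d) : Ready n m k ρ (s.setR d (s.R a - s.R b)) :=
  h.setR hd fun B hB => ((h.bits B hB a).sub (h.bits B hB b)).mono (by nlinarith)

theorem Ready.addR (h : Ready n m k ρ s) {d a b : ℕ} (hd : d ∈ Set.Icc 1 13)
    (hl : level a + level b + 1 ≤ level d) : Ready n m k ρ (s.setR d (s.R a + s.R b)) :=
  h.setR hd fun B hB => ((h.bits B hB a).add (h.bits B hB b)).mono (by nlinarith)

theorem Ready.mulR (h : Ready n m k ρ s) {d a b : ℕ} (hd : d ∈ Set.Icc 1 13)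
    (hl : level a + level b + 1 ≤ level d) : Ready n m k ρ (s.setR d (s.R a * s.R b)) :=
  h.setR hd fun B hB => ((h.bits B hB a).mul (h.bits B hB b)).mono (by nlinarith)

theorem one_le_level (j : ℕ) : 1 ≤ level j := by
  rcases lt_or_ge j 14 with h | h
  · interval_cases j <;> decide
  · exact (List.getD_eq_default _ _ h).ge

theorem Ready.loadR (h : Ready n m k ρ s) {d i : ℕ} (hd : d ∈ Set.Icc 1 13) :
    Ready n m k ρ (s.setR d (ρ i)) :=
  h.setR hd fun B hB => (hB i).mono (by nlinarith [one_le_level d])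

/-! ### Correctness of the program -/

variable {P P' : Program} {T : ℕ} {post : State → Prop}

theorem run_loadPoint {x y i a : ℕ} (hs : Ready n m k ρ s) (hi : s.W i = a) (ha : a < n + m)
    (hx : x ∈ Set.Icc 1 13) (hy : y ∈ Set.Icc 1 13) (hxy : x ≠ y)
    (h : ∀ s', Ready n m k ρ s' → Same 19 s s' → s'.R x = ρ (2 * a + 1) →
      s'.R y = ρ (2 * a + 2) → (∀ j, j ≠ x → j ≠ y → s'.R j = s.R j) →
      Run (LevelBits ρ) P T s' post) :
    Run (LevelBits ρ) (loadPoint x y i P) (T + 5) s post := by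
  have r1 := hs.setW (i := 19) (x := a + a) (by norm_num)
  have r2 := r1.setW (i := 19) (x := a + a + s.W 4) (by norm_num)
  have r3 := r2.loadR (i := 2 * a + 1) hx
  have r4 := r3.setW (i := 19) (x := a + a + s.W 4 + 1) (by norm_num)
  have r5 := r4.loadR (i := 2 * a + 2) hy
  refine Run.step ?_ r1.bits <| Run.step ?_ r2.bits <| Run.step ?_ r3.bits <|
    Run.step ?_ r4.bits <| Run.step ?_ r5.bits <| h _ r5 ?_ ?_ ?_ ?_
  · simp [Instr.run, hi]
  · simp [Instr.run, State.setW_W]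
  · have := hs.coord_eq (2 * a) (by omega)
    rw [show s.W 4 + 2 * a = a + a + s.W 4 by ring] at this
    simp [Instr.run, State.setW_W, State.setW_R, this]
  · simp [Instr.run, State.setW_W, State.setR_W, hs.one_eq]
  · have := hs.coord_eq (2 * a + 1) (by omega)
    rw [show s.W 4 + (2 * a + 1) = a + a + s.W 4 + 1 by ring] at this
    have h13 : a + a + s.W 4 + 1 ≠ x := by
      have := hs.base_le
      have := hx.2
      omega
    simp [Instr.run, State.setW_W, State.setW_R, State.setR_R, this, h13]
  · intro j hj
    simp [State.setW_W, State.setR_W, hj.ne]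
  · simp [State.setR_R, State.setW_R, hxy]
  · simp [State.setR_R]
  · intro j h1 h2
    simp [State.setR_R, State.setW_R, h1, h2]

theorem run_testFar {i j a b : ℕ} (hs : Ready n m k ρ s) (hi : s.W i = a) (hj : s.W j = b)
    (ha : a < n + m) (hb : b < n + m) (hj' : j < 19)
    (h : far ρ a b → ∀ s', Ready n m k ρ s' → Same 19 s s' → Run (LevelBits ρ) P T s' post)
    (h' : ¬ far ρ a b → ∀ s', Ready n m k ρ s' → Same 19 s s' → Run (LevelBits ρ) P' T s' post) :
    Run (LevelBits ρ) (testFar i j P P') (T + 16) s post := by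
  refine run_loadPoint (T := T + 11) hs hi ha (by simp) (by simp) (by simp)
    fun s1 r1 e1 x1 y1 _ => ?_
  refine run_loadPoint (T := T + 6) r1 ((e1 j hj').trans hj) hb (by simp) (by simp) (by simp)
    fun s2 r2 e2 x2 y2 f2 => ?_
  have x1' := (f2 1 (by simp) (by simp)).trans x1
  have y1' := (f2 2 (by simp) (by simp)).trans y1
  have r3 := r2.subR (d := 7) (a := 1) (b := 3) (by simp) (by decide)
  have r4 := r3.subR (d := 8) (a := 2) (b := 4) (by simp) (by decide)
  have r5 := r4.mulR (d := 11) (a := 7) (b := 7) (by simp) (by decide)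
  have r6 := r5.mulR (d := 12) (a := 8) (b := 8) (by simp) (by decide)
  have r7 := r6.addR (d := 13) (a := 11) (b := 12) (by simp) (by decide)
  refine Run.step rfl r3.bits <| Run.step rfl r4.bits <| Run.step rfl r5.bits <|
    Run.step rfl r6.bits <| Run.step rfl r7.bits <| Run.branch (fun hb => h ?_ _ r7 (e1.trans e2))
      (fun hb => h' ?_ _ r7 (e1.trans e2))
  all_goals
    simp only [Test.Holds, r7.sq_eq] at hb
    simpa [State.setR_R, x1', y1', x2, y2, far] using hb

theorem run_testTurn {o i j c a b : ℕ} (hs : Ready n m k ρ s) (ho : s.W o = c) (hi : s.W i = a)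
    (hj : s.W j = b) (hc : c < n + m) (ha : a < n + m) (hb : b < n + m) (hi' : i < 19)
    (hj' : j < 19)
    (h : leftTurn ρ c a b → ∀ s', Ready n m k ρ s' → Same 19 s s' →
      Run (LevelBits ρ) P T s' post)
    (h' : ¬ leftTurn ρ c a b → ∀ s', Ready n m k ρ s' → Same 19 s s' →
      Run (LevelBits ρ) P' T s' post) :
    Run (LevelBits ρ) (testTurn o i j P P') (T + 22) s post := by
  refine run_loadPoint (T := T + 17) hs ho hc (by simp) (by simp) (by simp)
    fun s1 r1 e1 x1 y1 _ => ?_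
  refine run_loadPoint (T := T + 12) r1 ((e1 i hi').trans hi) ha (by simp) (by simp) (by simp)
    fun s2 r2 e2 x2 y2 f2 => ?_
  refine run_loadPoint (T := T + 7) r2 (((e1.trans e2) j hj').trans hj) hb (by simp) (by simp)
    (by simp) fun s3 r3 e3 x3 y3 f3 => ?_
  have x1' := (f3 1 (by simp) (by simp)).trans ((f2 1 (by simp) (by simp)).trans x1)
  have y1' := (f3 2 (by simp) (by simp)).trans ((f2 2 (by simp) (by simp)).trans y1)
  have x2' := (f3 3 (by simp) (by simp)).trans x2
  have y2' := (f3 4 (by simp) (by simp)).trans y2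
  have r4 := r3.subR (d := 7) (a := 3) (b := 1) (by simp) (by decide)
  have r5 := r4.subR (d := 8) (a := 4) (b := 2) (by simp) (by decide)
  have r6 := r5.subR (d := 9) (a := 5) (b := 1) (by simp) (by decide)
  have r7 := r6.subR (d := 10) (a := 6) (b := 2) (by simp) (by decide)
  have r8 := r7.mulR (d := 11) (a := 7) (b := 10) (by simp) (by decide)
  have r9 := r8.mulR (d := 12) (a := 8) (b := 9) (by simp) (by decide)
  refine Run.step rfl r4.bits <| Run.step rfl r5.bits <| Run.step rfl r6.bits <|
    Run.step rfl r7.bits <| Run.step rfl r8.bits <| Run.step rfl r9.bits <|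
    Run.branch (fun hb => h ?_ _ r9 ((e1.trans e2).trans e3))
      (fun hb => h' ?_ _ r9 ((e1.trans e2).trans e3))
  all_goals
    simpa [Test.Holds, State.setR_R, x1', y1', x2', y2', x3, y3, leftTurn] using hb

end Ready

/-! ### The loops of the program -/

section Loops

variable {n m k : ℕ} {ρ : ℕ → ℝ} {s : State} {post : State → Prop}

theorem run_skip (hs : Ready n m k ρ s)
    (h : ∀ s', Ready n m k ρ s' → Same 18 s s' → post s') : Run (LevelBits ρ) skip 1 s post :=
  Run.instr rfl (hs.setW (by norm_num)).bits
    (h _ (hs.setW (by norm_num)) ((Same.refl 18 s).setW le_rfl))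

/-- A bound on the number of steps of `rankProg` on `N` points; likewise for the next definitions.
-/
def rankTime (N : ℕ) : ℕ := N * 42 + 3

def failTime (N : ℕ) : ℕ := N * (rankTime N + 37) + 3

def roundTime (N : ℕ) : ℕ := N * (failTime N + 4) + 3

def trialTime (N : ℕ) : ℕ := N * (roundTime N + 3) + failTime N + 6

def searchTime (N : ℕ) : ℕ := N * (N * (trialTime N + 2) + 4) + 3

theorem run_rankProg {c p v : ℕ} (hs : Ready n m k ρ s) (hc : s.W 8 = c) (hp : s.W 9 = p)
    (hv : s.W 15 = v) (hcN : c < n + m) (hpN : p < n + m) (hvN : v < n + m) :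
    Run (LevelBits ρ) rankProg (rankTime (n + m)) s fun s' => Ready n m k ρ s' ∧ Same 16 s s' ∧
      s'.W 16 = rank n (far ρ) (leftTurn ρ) c p v := by
  classical
  have r1 := hs.setW (i := 16) (x := 0) (by norm_num)
  have r2 := r1.setW (i := 17) (x := 0) (by norm_num)
  refine Run.mono (Run.step rfl r1.bits <| Run.step rfl r2.bits (T := (n - 0) * (40 + 2) + 1) ?_) ?_
    fun _ h => h
  · have inv0 : ∀ s', Ready n m k ρ s' → Same 16 s s' →
        s'.W 8 = c ∧ s'.W 9 = p ∧ s'.W 15 = v := fun s' _ e =>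
      ⟨(e 8 (by simp)).trans hc, (e 9 (by simp)).trans hp, (e 15 (by simp)).trans hv⟩
    refine (Run.upTo (n := n) (T := 40) (fun u s' => Ready n m k ρ s' ∧ Same 16 s s' ∧ s'.W 17 = u ∧
      s'.W 16 = Nat.count (fun u => ¬ far ρ c u ∧ leftTurn ρ p u v) u) ?_ ?_ (Nat.zero_le n)
      ⟨r2, ((Same.refl 16 s).setW le_rfl).setW (by simp), ?_, ?_⟩).mono le_rfl ?_
    · rintro j s' ⟨r, _, h, _⟩
      exact ⟨h, r.n_eq⟩
    · rintro u s1 hu ⟨r, e, h17, h16⟩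
      obtain ⟨c1, p1, v1⟩ := inv0 s1 r e
      -- The conditions at the end of the body, from which the increment restores the invariant.
      have fin : ∀ s2, Ready n m k ρ s2 → Same 16 s s2 → s2.W 17 = u →
          s2.W 16 = Nat.count (fun u => ¬ far ρ c u ∧ leftTurn ρ p u v) (u + 1) →
          s2.W 17 = u ∧ s2.W 3 = 1 ∧ LevelBits ρ (s2.setW 17 (u + 1)) ∧
            Ready n m k ρ (s2.setW 17 (u + 1)) ∧ Same 16 s (s2.setW 17 (u + 1)) ∧
            (s2.setW 17 (u + 1)).W 17 = u + 1 ∧ (s2.setW 17 (u + 1)).W 16 =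
              Nat.count (fun u => ¬ far ρ c u ∧ leftTurn ρ p u v) (u + 1) := by
        intro s2 r2 e2 h17 h16
        have r3 := r2.setW (i := 17) (x := u + 1) (by norm_num)
        exact ⟨h17, r2.one_eq, r3.bits, r3, e2.setW (by simp), by simp [State.setW_W],
          by simpa [State.setW_W] using h16⟩
      refine Run.mono (T := 24 + 16) (run_testFar r c1 h17 hcN (by omega) (by norm_num)
        (fun hf s2 r2 e2 => (run_skip r2 fun s3 r3 e3 => ?_).mono (by norm_num) fun _ h => h)
        (fun hf s2 r2 e2 => ?_)) (by norm_num) fun _ h => h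
      · have e3 := (e2.mono (by simp)).trans e3
        refine fin _ r3 (e.trans (e3.mono (by simp))) ((e3 17 (by simp)).trans h17) ?_
        rw [e3 16 (by simp), h16, Nat.count_succ, if_neg (by tauto), add_zero]
      · refine Run.mono (T := 1 + 22) (run_testTurn r2 ((e2 9 (by simp)).trans p1)
          ((e2 17 (by simp)).trans h17)
          ((e2 15 (by simp)).trans v1) hpN (by omega) hvN (by norm_num) (by norm_num)
          (fun ht s3 r3 e3 => ?_) (fun ht s3 r3 e3 => ?_)) (by norm_num) fun _ h => h
        · have e3 := e2.trans e3
          have r4 := r3.setW (i := 16) (x := s3.W 16 + s3.W 3) (by norm_num)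
          refine Run.instr rfl r4.bits (fin _ r4 ?_ ?_ ?_)
          · exact (e.trans (e3.mono (by simp))).setW le_rfl
          · simp [State.setW_W, e3 17, h17]
          · simp [State.setW_W, e3 16, h16, Nat.count_succ, hf, ht, r3.one_eq]
        · refine run_skip r3 fun s4 r4 e4 => ?_
          have e4 := ((e2.trans e3).mono (by simp)).trans e4
          refine fin _ r4 (e.trans (e4.mono (by simp))) ((e4 17 (by simp)).trans h17) ?_
          rw [e4 16 (by simp), h16, Nat.count_succ, if_neg (by tauto), add_zero]
    · simp [State.setW_W]
    · simp [State.setW_W]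
    · rintro s' ⟨r, e, _, h⟩
      exact ⟨r, e, h⟩
  · simp only [rankTime]; omega

theorem run_failProg {c p e τ : ℕ} (hs : Ready n m k ρ s) (hc : s.W 8 = c) (hp : s.W 9 = p)
    (he : s.W 13 = e) (hτ : s.W 11 = τ) (hcN : c < n + m) (hpN : p < n + m) (heN : e < n + m) :
    Run (LevelBits ρ) failProg (failTime (n + m)) s fun s' => Ready n m k ρ s' ∧ Same 14 s s' ∧
      s'.W 14 = failTo n (far ρ) (leftTurn ρ) c p e τ n := by
  have r1 := hs.setW (i := 14) (x := s.W 0 + s.W 6) (by norm_num)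
  have r2 := r1.setW (i := 15) (x := 0) (by norm_num)
  refine Run.mono (Run.step rfl r1.bits <| Run.step rfl r2.bits
    (T := (n - 0) * (rankTime (n + m) + 35 + 2) + 1) ?_) ?_ fun _ h => h
  refine (Run.upTo (n := n) (fun v s' => Ready n m k ρ s' ∧ Same 14 s s' ∧ s'.W 15 = v ∧
    s'.W 14 = failTo n (far ρ) (leftTurn ρ) c p e τ v) ?_ ?_ (Nat.zero_le n)
    ⟨r2, ((Same.refl 14 s).setW le_rfl).setW (by simp), ?_, ?_⟩).mono le_rfl ?_
  · rintro j s' ⟨r, _, h, _⟩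
    exact ⟨h, r.n_eq⟩
  · rintro v s1 hv ⟨r, e1, h15, h14⟩
    have c1 := (e1 8 (by simp)).trans hc
    have p1 := (e1 9 (by simp)).trans hp
    have e1' := (e1 13 (by simp)).trans he
    have τ1 := (e1 11 (by simp)).trans hτ
    have fin : ∀ s2, Ready n m k ρ s2 → Same 14 s s2 → s2.W 15 = v →
        s2.W 14 = failTo n (far ρ) (leftTurn ρ) c p e τ (v + 1) →
        s2.W 15 = v ∧ s2.W 3 = 1 ∧ LevelBits ρ (s2.setW 15 (v + 1)) ∧
          Ready n m k ρ (s2.setW 15 (v + 1)) ∧ Same 14 s (s2.setW 15 (v + 1)) ∧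
          (s2.setW 15 (v + 1)).W 15 = v + 1 ∧ (s2.setW 15 (v + 1)).W 14 =
            failTo n (far ρ) (leftTurn ρ) c p e τ (v + 1) := by
      intro s2 r2 e2 h15 h14
      have r3 := r2.setW (i := 15) (x := v + 1) (by norm_num)
      exact ⟨h15, r2.one_eq, r3.bits, r3, e2.setW (by simp), by simp [State.setW_W],
        by simpa [State.setW_W] using h14⟩
    -- The same if the body ends without a change of the minimum.
    have fin' : ∀ s2, Ready n m k ρ s2 → Same 16 s1 s2 →
        ¬ (¬ far ρ c v ∧ ¬ far ρ e v ∧ τ ≤ rank n (far ρ) (leftTurn ρ) c p v ∧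
          rank n (far ρ) (leftTurn ρ) c p v < failTo n (far ρ) (leftTurn ρ) c p e τ v) →
        s2.W 15 = v ∧ s2.W 3 = 1 ∧ LevelBits ρ (s2.setW 15 (v + 1)) ∧
          Ready n m k ρ (s2.setW 15 (v + 1)) ∧ Same 14 s (s2.setW 15 (v + 1)) ∧
          (s2.setW 15 (v + 1)).W 15 = v + 1 ∧ (s2.setW 15 (v + 1)).W 14 =
            failTo n (far ρ) (leftTurn ρ) c p e τ (v + 1) := by
      intro s2 r2 e2 h
      refine fin s2 r2 (e1.trans (e2.mono (by simp))) ((e2 15 (by simp)).trans h15) ?_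
      rw [e2 14 (by simp), h14, failTo, if_neg h]
    refine Run.mono (T := rankTime (n + m) + 3 + 16 + 16) (run_testFar r c1 h15 hcN (by omega)
      (by norm_num)
      (fun hf s2 r2 e2 => (run_skip r2 fun s3 r3 e3 => ?_).mono (by omega) fun _ h => h)
      (fun hf s2 r2 e2 => ?_)) (by omega) fun _ h => h
    · exact fin' _ r3 (((e2.mono (by simp)).trans e3).mono (by simp)) (by tauto)
    refine run_testFar r2 ((e2 13 (by simp)).trans e1') ((e2 15 (by simp)).trans h15) heN
      (by omega) (by norm_num)
      (fun hf' s3 r3 e3 => (run_skip r3 fun s4 r4 e4 => ?_).mono (by omega) fun _ h => h)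
      (fun hf' s3 r3 e3 => ?_)
    · exact fin' _ r4 ((((e2.trans e3).mono (by simp)).trans e4).mono (by simp)) (by tauto)
    have e3 := e2.trans e3
    refine (run_rankProg r3 ((e3 8 (by simp)).trans c1) ((e3 9 (by simp)).trans p1)
      ((e3 15 (by simp)).trans h15) hcN hpN (by omega)).seq ?_
    rintro s4 ⟨r4, e4, h16⟩
    have e4 := (e3.mono (by simp)).trans e4
    refine Run.branch (T := 2) (fun hb => ?_)
      fun hb => (run_skip r4 fun s5 r5 e5 => ?_).mono (by omega) fun _ h => h
    · simp only [Test.Holds, h16, e4 11 (by simp), τ1] at hb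
      refine Run.branch (fun hb' => ?_) fun hb' => run_skip r4 fun s5 r5 e5 => ?_
      · simp only [Test.Holds, h16, e4 14 (by simp), h14] at hb'
        have r5 := r4.setW (i := 14) (x := s4.W 16 + s4.W 6) (by norm_num)
        refine Run.instr rfl r5.bits (fin _ r5 ?_ ?_ ?_)
        · exact (e1.trans (e4.mono (by simp))).setW le_rfl
        · simp [State.setW_W, e4 15, h15]
        · simp [State.setW_W, h16, r4.zero_eq, failTo, hf, hf', hb, hb']
      · simp only [Test.Holds, h16, e4 14 (by simp), h14] at hb'
        exact fin' _ r5 (e4.trans (e5.mono (by simp))) (by tauto)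
    · simp only [Test.Holds, h16, e4 11 (by simp), τ1] at hb
      exact fin' _ r5 (e4.trans (e5.mono (by simp))) (by tauto)
  · simp [State.setW_W]
  · simp [State.setW_W, failTo, hs.n_eq, hs.zero_eq]
  · rintro s' ⟨r, e, _, h⟩
    exact ⟨r, e, h⟩
  · have : (n - 0) * (rankTime (n + m) + 35 + 2) ≤ (n + m) * (rankTime (n + m) + 37) := by
      gcongr; omega
    simp only [failTime]; omega

theorem run_roundProg {c p τ : ℕ} (hs : Ready n m k ρ s) (hc : s.W 8 = c) (hp : s.W 9 = p)
    (hτ : s.W 11 = τ) (hcN : c < n + m) (hpN : p < n + m) :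
    Run (LevelBits ρ) roundProg (roundTime (n + m)) s fun s' => Ready n m k ρ s' ∧ Same 12 s s' ∧
      s'.W 12 = nextThreshold n (n + m) (far ρ) (leftTurn ρ) c p τ := by
  have r1 := hs.setW (i := 12) (x := 0) (by norm_num)
  have r2 := r1.setW (i := 13) (x := s.W 0 + s.W 6) (by norm_num)
  refine Run.mono (Run.step rfl r1.bits <| Run.step rfl r2.bits
    (T := (n + m - n) * (failTime (n + m) + 2 + 2) + 1) ?_) ?_ fun _ h => h
  refine (Run.upTo (n := n + m) (fun j s' => Ready n m k ρ s' ∧ Same 12 s s' ∧ s'.W 13 = j ∧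
    n ≤ j ∧ s'.W 12 = nextThreshold n j (far ρ) (leftTurn ρ) c p τ) ?_ ?_ (Nat.le_add_right n m)
    ⟨r2, ((Same.refl 12 s).setW le_rfl).setW (by simp), ?_, le_rfl, ?_⟩).mono le_rfl ?_
  · rintro j s' ⟨r, _, h, _⟩
    exact ⟨h, r.size_eq⟩
  · rintro j s1 hj ⟨r, e1, h13, hnj, h12⟩
    have fin : ∀ s2, Ready n m k ρ s2 → Same 12 s s2 → s2.W 13 = j →
        s2.W 12 = max (nextThreshold n j (far ρ) (leftTurn ρ) c p τ)
          (failTo n (far ρ) (leftTurn ρ) c p j τ n) →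
        s2.W 13 = j ∧ s2.W 3 = 1 ∧ LevelBits ρ (s2.setW 13 (j + 1)) ∧
          Ready n m k ρ (s2.setW 13 (j + 1)) ∧ Same 12 s (s2.setW 13 (j + 1)) ∧
          (s2.setW 13 (j + 1)).W 13 = j + 1 ∧ n ≤ j + 1 ∧ (s2.setW 13 (j + 1)).W 12 =
            nextThreshold n (j + 1) (far ρ) (leftTurn ρ) c p τ := by
      intro s2 r2 e2 h13 h12
      have r3 := r2.setW (i := 13) (x := j + 1) (by norm_num)
      refine ⟨h13, r2.one_eq, r3.bits, r3, e2.setW (by simp), by simp [State.setW_W],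
        by omega, ?_⟩
      rw [State.setW_W, if_neg (by norm_num), h12, nextThreshold, nextThreshold,
        ← Finset.insert_Ico_right_eq_Ico_add_one hnj, Finset.sup_insert, max_comm]
    refine (run_failProg r ((e1 8 (by simp)).trans hc) ((e1 9 (by simp)).trans hp) h13
      ((e1 11 (by simp)).trans hτ) hcN hpN hj).seq ?_
    rintro s2 ⟨r2, e2, h14⟩
    have h13' := (e2 13 (by simp)).trans h13
    have h12' := (e2 12 (by simp)).trans h12
    have e2' := e1.trans (e2.mono (by simp))
    refine Run.branch (fun hb => ?_) fun hb => run_skip r2 fun s3 r3 e3 => ?_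
    · simp only [Test.Holds, h14, h12'] at hb
      have r3 := r2.setW (i := 12) (x := s2.W 14 + s2.W 6) (by norm_num)
      refine Run.instr rfl r3.bits (fin _ r3 ?_ ?_ ?_)
      · exact e2'.setW le_rfl
      · simp [State.setW_W, h13']
      · simp [State.setW_W, h14, r2.zero_eq, hb.le]
    · simp only [Test.Holds, h14, h12'] at hb
      refine fin s3 r3 (e2'.trans (e3.mono (by simp))) ((e3 13 (by simp)).trans h13') ?_
      rw [e3 12 (by simp), h12', max_eq_left (not_lt.1 hb)]
  · simp [State.setW_W, hs.n_eq, hs.zero_eq]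
  · simp [State.setW_W, nextThreshold]
  · rintro s' ⟨r, e, _, _, h⟩
    exact ⟨r, e, h⟩
  · have : (n + m - n) * (failTime (n + m) + 2 + 2) ≤ (n + m) * (failTime (n + m) + 4) := by
      gcongr; omega
    simp only [roundTime]; omega

open Classical in
theorem run_trialProg {c p : ℕ} (hs : Ready n m k ρ s) (hk : 1 ≤ k) (hkm : k ≤ m)
    (hc : s.W 8 = c) (hp : s.W 9 = p) (hcN : c < n + m) (hpN : p < n + m) :
    Run (LevelBits ρ) trialProg (trialTime (n + m)) s fun s' => Ready n m k ρ s' ∧ Same 7 s s' ∧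
      s'.W 8 = c ∧ s'.W 9 = p ∧
      s'.W 7 = if Accepts n (n + m) k (far ρ) (leftTurn ρ) c p then 1 else s.W 7 := by
  have r1 := hs.setW (i := 11) (x := 0) (by norm_num)
  have r2 := r1.setW (i := 10) (x := 1) (by norm_num)
  refine Run.mono (Run.step rfl r1.bits <| Run.step rfl r2.bits
    (T := ((k - 1) * (roundTime (n + m) + 1 + 2) + 1) + (failTime (n + m) + 2 + 1)) ?_) ?_
    fun _ h => h
  · refine (Run.upTo (n := k) (fun j s' => Ready n m k ρ s' ∧ Same 10 s s' ∧ s'.W 10 = j ∧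
      1 ≤ j ∧ s'.W 11 = threshold n (n + m) (far ρ) (leftTurn ρ) c p (j - 1)) ?_ ?_ hk
      ⟨r2, ((Same.refl 10 s).setW (by simp)).setW le_rfl, ?_, le_rfl, ?_⟩).seq ?_
    · rintro j s' ⟨r, _, h, _⟩
      exact ⟨h, r.k_eq⟩
    · rintro j s1 hj ⟨r, e1, h10, hj1, h11⟩
      refine (run_roundProg r ((e1 8 (by simp)).trans hc) ((e1 9 (by simp)).trans hp) h11
        hcN hpN).seq ?_
      rintro s2 ⟨r2, e2, h12⟩
      have h10' := (e2 10 (by simp)).trans h10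
      have r3 := r2.setW (i := 11) (x := s2.W 12 + s2.W 6) (by norm_num)
      have r4 := r3.setW (i := 10) (x := j + 1) (by norm_num)
      refine Run.instr rfl r3.bits ⟨?_, r3.one_eq, r4.bits, r4, ?_, ?_, by omega, ?_⟩
      · simp [State.setW_W, h10']
      · exact ((e1.trans (e2.mono (by simp))).setW (by simp)).setW le_rfl
      · simp [State.setW_W]
      · obtain ⟨i, rfl⟩ : ∃ i, j = i + 1 := ⟨j - 1, by omega⟩
        simp [State.setW_W, h12, r2.zero_eq, threshold]
    · simp [State.setW_W]
    · simp [State.setW_W, threshold]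
    rintro s1 ⟨r, e1, h10, -, h11⟩
    have r3 := r.setW (i := 13) (x := s1.W 8 + s1.W 6) (by norm_num)
    have e3 := e1.setW (i := 13) (x := s1.W 8 + s1.W 6) (by simp)
    refine Run.step rfl r3.bits ?_
    refine (run_failProg (e := c) r3 ((e3 8 (by simp)).trans hc) ((e3 9 (by simp)).trans hp) ?_
      (τ := threshold n (n + m) (far ρ) (leftTurn ρ) c p (k - 1)) ?_ hcN hpN hcN).seq ?_
    · simp [State.setW_W, r.zero_eq, e1 8, hc]
    · simp [State.setW_W, h11]
    rintro s4 ⟨r4, e4, h14⟩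
    have e4 := e3.trans (e4.mono (by simp))
    refine Run.branch (fun hb => ?_) fun hb => run_skip r4 fun s5 r5 e5 => ?_
    · have hb : Accepts n (n + m) k (far ρ) (leftTurn ρ) c p := by
        simpa only [Test.Holds, h14, r4.n_eq, Accepts] using hb
      have r5 := r4.setW (i := 7) (x := 1) (by norm_num)
      refine Run.instr rfl r5.bits ⟨r5, (e4.mono (by simp)).setW le_rfl, ?_, ?_, ?_⟩
      · simp [State.setW_W, e4 8, hc]
      · simp [State.setW_W, e4 9, hp]
      · simp [State.setW_W, hb]
    · have hb : ¬ Accepts n (n + m) k (far ρ) (leftTurn ρ) c p := by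
        simpa only [Test.Holds, h14, r4.n_eq, Accepts] using hb
      have e5 := e4.trans (e5.mono (by simp))
      exact ⟨r5, e5.mono (by simp), (e5 8 (by simp)).trans hc, (e5 9 (by simp)).trans hp,
        by rw [if_neg hb, e5 7 (by simp)]⟩
  · have : (k - 1) * (roundTime (n + m) + 1 + 2) ≤ (n + m) * (roundTime (n + m) + 3) := by
      gcongr; omega
    simp only [trialTime]; omega

open Classical in
theorem run_searchProg (hs : Ready n m k ρ s) (hk : 1 ≤ k) (hkm : k ≤ m) :
    Run (LevelBits ρ) searchProg (searchTime (n + m)) s fun s' => Ready n m k ρ s' ∧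
      s'.W 7 = if ∃ c ∈ Finset.Ico n (n + m), ∃ p < n,
        Accepts n (n + m) k (far ρ) (leftTurn ρ) c p then 1 else 0 := by
  set A := Accepts n (n + m) k (far ρ) (leftTurn ρ) with hA
  have r1 := hs.setW (i := 7) (x := 0) (by norm_num)
  have r2 := r1.setW (i := 8) (x := s.W 0 + s.W 6) (by norm_num)
  refine Run.mono (Run.step rfl r1.bits <| Run.step rfl r2.bits
    (T := (n + m - n) * (((n - 0) * (trialTime (n + m) + 2) + 1 + 1) + 2) + 1) ?_) ?_ fun _ h => h
  · refine (Run.upTo (n := n + m) (fun j s' => Ready n m k ρ s' ∧ s'.W 8 = j ∧ n ≤ j ∧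
      s'.W 7 = if ∃ c ∈ Finset.Ico n j, ∃ p < n, A c p then 1 else 0) ?_ ?_
      (Nat.le_add_right n m) ⟨r2, ?_, le_rfl, ?_⟩).mono le_rfl ?_
    · rintro j s' ⟨r, h, _⟩
      exact ⟨h, r.size_eq⟩
    · rintro c s1 hc ⟨r, h8, hnc, h7⟩
      have r3 := r.setW (i := 9) (x := 0) (by norm_num)
      refine Run.step rfl r3.bits ?_
      refine (Run.upTo (n := n) (fun j s' => Ready n m k ρ s' ∧ s'.W 9 = j ∧ s'.W 8 = c ∧
        s'.W 7 = if (∃ c' ∈ Finset.Ico n c, ∃ p < n, A c' p) ∨ ∃ p < j, A c p then 1 else 0) ?_ ?_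
        (Nat.zero_le n) ⟨r3, ?_, ?_, ?_⟩).mono le_rfl ?_
      · rintro j s' ⟨r, h, _⟩
        exact ⟨h, r.n_eq⟩
      · rintro p s2 hp ⟨r, h9, h8, h7⟩
        refine (run_trialProg r hk hkm h8 h9 hc (by omega)).mono le_rfl ?_
        rintro s3 ⟨r3, -, h8', h9', h7'⟩
        have r4 := r3.setW (i := 9) (x := p + 1) (by norm_num)
        refine ⟨h9', r3.one_eq, r4.bits, r4, by simp [State.setW_W],
          by simp [State.setW_W, h8'], ?_⟩
        rw [State.setW_W, if_neg (by norm_num), h7', h7]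
        simp only [Nat.lt_succ_iff_lt_or_eq, or_and_right, exists_or, exists_eq_left]
        by_cases h : A c p <;> simp [← hA, h]
      · simp [State.setW_W]
      · simp [State.setW_W, h8]
      · rw [State.setW_W, if_neg (by norm_num), h7]
        exact if_congr (by simp) rfl rfl
      · rintro s3 ⟨r3, h9', h8', h7'⟩
        have r4 := r3.setW (i := 8) (x := c + 1) (by norm_num)
        refine ⟨h8', r3.one_eq, r4.bits, r4, by simp [State.setW_W], by omega, ?_⟩
        rw [State.setW_W, if_neg (by norm_num), h7']
        refine if_congr ?_ rfl rfl
        rw [← Finset.insert_Ico_right_eq_Ico_add_one hnc]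
        simp only [Finset.mem_insert, or_and_right, exists_or, exists_eq_left]
        exact or_comm
    · simp [State.setW_W, hs.n_eq, hs.zero_eq]
    · simp [State.setW_W]
    · rintro s' ⟨r, _, _, h⟩
      exact ⟨r, h⟩
  · have : (n + m - n) * (((n - 0) * (trialTime (n + m) + 2) + 1 + 1) + 2) ≤
        (n + m) * ((n + m) * (trialTime (n + m) + 2) + 4) := by
      have : (n - 0) * (trialTime (n + m) + 2) ≤ (n + m) * (trialTime (n + m) + 2) := by
        gcongr; omega
      exact Nat.mul_le_mul (by omega) (by omega)
    simp only [searchTime]; omega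

/-- During the initialization real numbers are only copied, except in the last step. -/
theorem LevelBits.of_copy (h : ∀ i, ∃ j, s.R i = ρ j) : LevelBits ρ s := by
  intro B hB i
  obtain ⟨j, hj⟩ := h i
  rw [hj]
  exact (hB j).mono (by nlinarith [one_le_level i])

theorem run_initProg (hW : ∀ i, s.W i = [n, m, k].getD i 0) (hR : s.R = ρ) :
    Run (LevelBits ρ) initProg ((n + m) * 10 + 10) s (Ready n m k ρ) := by
  subst hR
  have W0 := hW 0
  have W1 := hW 1
  have W2 := hW 2
  have W6 := hW 6
  simp only [List.getD_cons_zero, List.getD_cons_succ, List.getD_nil] at W0 W1 W2 W6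
  have q : ∀ s', s'.R = s.R → LevelBits s.R s' := fun s' h =>
    LevelBits.of_copy fun i => ⟨i, by rw [h]⟩
  -- The coordinates occupy the cells `1` to `2 * (n + m)`. The copy is out of their way, and out of
  -- the way of the registers.
  set A := 2 * (n + m) + 14 with hA
  refine Run.mono (Run.step rfl (q _ rfl) <| Run.step rfl (q _ rfl) <| Run.step rfl (q _ rfl) <|
    Run.step rfl (q _ rfl) <| Run.step rfl (q _ rfl) <| Run.step rfl (q _ rfl) <|
    Run.step rfl (q _ rfl) <| Run.step rfl (q _ rfl) <|
    ((Run.upTo (n := 2 * (n + m) + 1) (T := 3) (fun j s' =>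
      (∀ i, ∃ l, s'.R i = s.R l) ∧ s'.W 0 = n ∧ s'.W 1 = m ∧ s'.W 2 = k ∧ s'.W 3 = 1 ∧
      s'.W 4 = A ∧ s'.W 5 = n + m ∧ s'.W 6 = 0 ∧ s'.W 8 = 2 * (n + m) + 1 ∧ s'.W 9 + 1 = A + j ∧
      s'.W 10 = j ∧ 1 ≤ j ∧ (j = 1 → s'.R 1 = s.R 1) ∧ (∀ i < A, i ≠ 1 → s'.R i = s.R i) ∧
      ∀ i, i + 1 < j → s'.R (A + i) = s.R (i + 1)) ?_ ?_ (j := 1) (by omega) ?_).seq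
      (T' := 1) ?_)) ?_ fun _ h => h
  · rintro j s' h
    tauto
  · rintro j s1 hj ⟨hc, w0, w1, w2, w3, w4, w5, w6, w8, w9, w10, hj1, h1, hlow, hhigh⟩
    -- The cell `1` through which the numbers pass is itself the first one to be copied.
    have load : s1.R j = s.R j := by
      rcases eq_or_ne j 1 with rfl | h
      · exact h1 rfl
      · exact hlow j (by omega) h
    have c1 : ∀ i, ∃ l, (s1.setR 1 (s.R j)).R i = s.R l := by
      intro i
      rw [State.setR_R]
      split_ifs
      · exact ⟨j, rfl⟩
      · exact hc i
    have c2 : ∀ i, ∃ l, ((s1.setR 1 (s.R j)).setR (s1.W 9) (s.R j)).R i = s.R l := by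
      intro i
      rw [State.setR_R]
      split_ifs
      · exact ⟨j, rfl⟩
      · exact c1 i
    refine Run.step (s' := s1.setR 1 (s.R j)) ?_ (LevelBits.of_copy c1) <|
      Run.step (s' := (s1.setR 1 (s.R j)).setR (s1.W 9) (s.R j)) ?_ (LevelBits.of_copy c2) <|
      Run.instr rfl (LevelBits.of_copy c2) ?_
    · simp [Instr.run, w10, load]
    · simp [Instr.run, State.setR_W, State.setR_R]
    · simp only [State.setW_W, State.setW_R, State.setR_W]
      simp only [w0, w1, w2, w3, w4, w5, w6, w8, w10]
      refine ⟨by simp, by simp, LevelBits.of_copy c2, c2, by simp, by simp, by simp, by simp,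
        by simp, by simp, by simp, by simp, ?_, by simp, by omega, fun h => by omega, ?_, ?_⟩
      · simp only [reduceIte, Nat.reduceEqDiff]; omega
      · intro i hi hi1
        rw [State.setR_R, if_neg (by omega), State.setR_R, if_neg hi1, hlow i hi hi1]
      · intro i hi
        rw [State.setR_R]
        split_ifs with h
        · congr 1; omega
        · rw [State.setR_R, if_neg (by omega), hhigh i (by omega)]
  · simp only [State.setW_W, State.setW_R]
    simp only [W0, W1, W2, W6, reduceIte, Nat.reduceEqDiff, OfNat.zero_ne_ofNat,
      OfNat.one_ne_ofNat]
    refine ⟨fun i => ⟨i, rfl⟩, trivial, trivial, trivial, trivial, by omega, trivial, trivial,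
      by omega, by omega, trivial, le_rfl, ?_, ?_, fun i hi => by omega⟩
    all_goals simp
  · rintro s1 ⟨hc, w0, w1, w2, w3, w4, w5, w6, w8, w9, w10, hj1, h1, hlow, hhigh⟩
    have h0 : s1.R 0 = s.R 0 := hlow 0 (by omega) (by norm_num)
    have b : LevelBits s.R (s1.setR 0 (s1.R 0 * s1.R 0)) := by
      intro B hB i
      rw [State.setR_R]
      split_ifs with h
      · rw [h, h0]
        exact ((hB 0).mul (hB 0)).mono (by simp only [level, List.getD_cons_zero]; omega)
      · exact LevelBits.of_copy hc B hB i
    refine Run.instr rfl b ⟨b, w0, w1, w2, w3, ?_, w5, w6, ?_, ?_⟩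
    · rw [State.setR_W, w4]; omega
    · simp [State.setR_R, h0]
    · intro i hi
      rw [State.setR_W, w4, State.setR_R, if_neg (by omega), hhigh i (by omega)]
  · omega

/-- The bound on the running time of `mainProg` on `N` points. -/
def mainTime (N : ℕ) : ℕ := N * 10 + searchTime N + 13

open Classical in
theorem run_mainProg (hk : 1 ≤ k) (hW : ∀ i, s.W i = [n, m, k].getD i 0) (hR : s.R = ρ) :
    Run (LevelBits ρ) mainProg (mainTime (n + m)) s fun s' => s'.W 0 =
      if k ≤ m ∧ (n = 0 ∨ ∃ c ∈ Finset.Ico n (n + m), ∃ p < n,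
        Accepts n (n + m) k (far ρ) (leftTurn ρ) c p) then 1 else 0 := by
  refine Run.mono ((run_initProg hW hR).seq (T' := searchTime (n + m) + 1 + 1 + 1) fun s1 r1 => ?_)
    (by simp only [mainTime]; omega) fun _ h => h
  refine Run.branch (fun hb => ?_) fun hb => Run.branch (fun hb' => ?_) fun hb' => ?_
  · simp only [Test.Holds, r1.m_eq, r1.k_eq] at hb
    refine (Run.instr rfl (s' := s1.setW 0 0) r1.bits ?_).mono (by omega) fun _ h => h
    rw [if_neg (by omega)]
    simp [State.setW_W]
  · simp only [Test.Holds, r1.m_eq, r1.k_eq] at hb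
    simp only [Test.Holds, r1.n_eq, r1.one_eq] at hb'
    refine (Run.instr rfl (s' := s1.setW 0 1) r1.bits ?_).mono (by omega) fun _ h => h
    rw [if_pos ⟨by omega, Or.inl (by omega)⟩]
    simp [State.setW_W]
  · simp only [Test.Holds, r1.m_eq, r1.k_eq] at hb
    simp only [Test.Holds, r1.n_eq, r1.one_eq] at hb'
    refine (run_searchProg r1 hk (by omega)).seq fun s2 ⟨r2, h2⟩ => ?_
    refine Run.instr rfl (s' := s2.setW 0 (s2.W 7 + s2.W 6)) r2.bits ?_
    rw [State.setW_W, if_pos rfl, h2, r2.zero_eq, add_zero]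
    exact if_congr (by
      rw [iff_true_intro (not_lt.1 hb), true_and, iff_false_intro (show n ≠ 0 by omega),
        false_or]) rfl rfl

end Loops

/-! ### From a program to a polynomial -/

/-- A program that decides the instances within `f` steps and keeps to the bounds on the real
cells decides them in polynomial time, as the bounds on the integer cells come for free. -/
theorem decidesInPolyTime_of_run {α : Type} {input : α → State} {size : α → ℕ} {Yes : α → Prop}
    (P : Program) (f : Polynomial ℕ) (hf : Monotone fun x => f.eval x)
    (hW : ∀ a, ∃ i j l, ∀ x, (input a).W x = [i, j, l].getD x 0)
    (h : ∀ a, Run (LevelBits (input a).R) P (f.eval (size a)) (input a) fun s' =>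
      (Yes a → s'.W 0 = 1) ∧ (¬ Yes a → s'.W 0 = 0)) :
    DecidesInPolyTime input size Yes := by
  refine ⟨P, f + Polynomial.C 18 * Polynomial.X + Polynomial.C (15 + P.constBits), fun a => ?_⟩
  obtain ⟨T, hT, s', e, hp⟩ := h a
  obtain ⟨i, j, l, hW⟩ := hW a
  -- An integer cell has at most `constBits P + 3 * B` bits at the start and gains one per step; a
  -- real cell has at most `15 * (B + 1)` bits.
  have hev : ∀ x, (f + Polynomial.C 18 * Polynomial.X + Polynomial.C (15 + P.constBits)).eval x =
      f.eval x + 18 * x + (15 + P.constBits) := by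
    intro x
    simp only [Polynomial.eval_add, Polynomial.eval_mul, Polynomial.eval_X, Polynomial.eval_C]
  simp only [hev]
  refine ⟨T, s', ?_, by omega, hp⟩
  have e' := (e.size_le (P.constBits + i.size + j.size + l.size) (by omega) ?_).1
  · refine e'.mono fun s hs B hB => ?_
    have hmono : f.eval (size a) ≤ f.eval (size a + B) := hf (Nat.le_add_right _ _)
    refine ⟨fun x => (hs.2 x).trans ?_, fun x => ?_⟩
    · have h0 := hB.1 0
      have h1 := hB.1 1
      have h2 := hB.1 2
      rw [hW] at h0 h1 h2
      simp only [List.getD_cons_zero, List.getD_cons_succ] at h0 h1 h2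
      omega
    · refine (hs.1 B hB.2 x).mono ?_
      have : level x ≤ 15 := by
        rcases lt_or_ge x 14 with h | h
        · interval_cases x <;> decide
        · rw [level, List.getD_eq_default _ _ h]
          norm_num
      nlinarith
  · intro x
    rw [hW]
    match x with
    | 0 => simp only [List.getD_cons_zero]; omega
    | 1 => simp only [List.getD_cons_zero, List.getD_cons_succ]; omega
    | 2 => simp only [List.getD_cons_zero, List.getD_cons_succ]; omega
    | x + 3 => simp

/-- `mainTime` as a polynomial. -/
noncomputable def timePoly : Polynomial ℕ :=
  open Polynomial in
  let rank : ℕ[X] := X * C 42 + C 3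
  let fail : ℕ[X] := X * (rank + C 37) + C 3
  let next : ℕ[X] := X * (fail + C 4) + C 3
  let trial : ℕ[X] := X * (next + C 3) + fail + C 6
  X * C 10 + (X * (X * (trial + C 2) + C 4) + C 3) + C 13

theorem timePoly_eval (N : ℕ) : timePoly.eval N = mainTime N := by
  simp only [timePoly, mainTime, searchTime, trialTime, roundTime, failTime, rankTime,
    Polynomial.eval_add, Polynomial.eval_mul, Polynomial.eval_X, Polynomial.eval_C]

theorem mainTime_mono : Monotone mainTime := by
  intro a b h
  simp only [mainTime, searchTime, trialTime, roundTime, failTime, rankTime]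
  gcongr

/-! ### Correctness of the greedy choice -/

section Greedy

variable {n N : ℕ} {cov : ℕ → ℕ → Prop} {before : ℕ → ℕ → ℕ → Prop} {c p e τ : ℕ}

theorem rank_lt (hirr : ∀ v, ¬ before p v v) {v : ℕ} (hv : v < n) :
    rank n cov before c p v < n := by
  classical
  rw [rank, Nat.count_eq_card_filter_range]
  refine (Finset.card_lt_card (Finset.filter_ssubset.2 ⟨v, Finset.mem_range.2 hv, ?_⟩)).trans_eq
    (Finset.card_range n)
  exact fun h => hirr v h.2

theorem failTo_le_rank {j v : ℕ} (hv : v < j) (hc : ¬ cov c v) (he : ¬ cov e v)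
    (hτ : τ ≤ rank n cov before c p v) :
    failTo n cov before c p e τ j ≤ rank n cov before c p v := by
  classical
  induction j with
  | zero => omega
  | succ j ih =>
    rw [failTo]
    rcases Nat.lt_succ_iff_lt_or_eq.1 hv with h | rfl
    · split_ifs with h'
      · exact (h'.2.2.2.le).trans (ih h)
      · exact ih h
    · split_ifs with h'
      · exact le_rfl
      · by_contra hlt
        exact h' ⟨hc, he, hτ, not_le.1 hlt⟩

theorem exists_rank_eq_failTo {j : ℕ} (h : failTo n cov before c p e τ j < n) :
    ∃ v < j, ¬ cov c v ∧ ¬ cov e v ∧ τ ≤ rank n cov before c p v ∧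
      rank n cov before c p v = failTo n cov before c p e τ j := by
  classical
  induction j with
  | zero => exact absurd h (lt_irrefl n)
  | succ j ih =>
    rw [failTo] at h ⊢
    split_ifs with h'
    · exact ⟨j, by omega, h'.1, h'.2.1, h'.2.2.1, rfl⟩
    · rw [if_neg h'] at h
      obtain ⟨v, hv, h⟩ := ih h
      exact ⟨v, by omega, h⟩

/-- Whatever the order `before` is, the candidates that the greedy choice has made cover all
voters that are not covered by `c` and have a rank below the threshold. -/
theorem exists_cover_lt_threshold (hN : n < N) (j : ℕ) :
    ∃ D ⊆ Finset.Ico n N, D.card ≤ j ∧ ∀ v < n, ¬ cov c v →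
      rank n cov before c p v < threshold n N cov before c p j → ∃ e ∈ D, cov e v := by
  classical
  induction j with
  | zero => exact ⟨∅, by simp, by simp, fun v _ _ h => absurd h (Nat.not_lt_zero _)⟩
  | succ j ih =>
    obtain ⟨D, hD, hcard, hcov⟩ := ih
    obtain ⟨e, he, hmax⟩ := Finset.exists_mem_eq_sup (Finset.Ico n N) (Finset.nonempty_Ico.2 hN)
      fun e => failTo n cov before c p e (threshold n N cov before c p j) n
    refine ⟨insert e D, Finset.insert_subset he hD,
      (Finset.card_insert_le _ _).trans (by omega), fun v hv hc hlt => ?_⟩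
    rw [threshold, nextThreshold, hmax] at hlt
    rcases lt_or_ge (rank n cov before c p v) (threshold n N cov before c p j) with h | h
    · obtain ⟨d, hd, h⟩ := hcov v hv hc h
      exact ⟨d, Finset.mem_insert_of_mem hd, h⟩
    · refine ⟨e, Finset.mem_insert_self _ _, ?_⟩
      by_contra he
      exact absurd (failTo_le_rank hv hc he h) (not_le.2 hlt)

/-- Soundness of the algorithm. -/
theorem Accepts.exists_cover {k : ℕ} (hk : 1 ≤ k) (hirr : ∀ v, ¬ before p v v)
    (hc : c ∈ Finset.Ico n N) (h : Accepts n N k cov before c p) :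
    ∃ D ⊆ Finset.Ico n N, D.card ≤ k ∧ ∀ v < n, ∃ e ∈ D, cov e v := by
  classical
  have hc' := Finset.mem_Ico.1 hc
  obtain ⟨D, hD, hcard, hcov⟩ := exists_cover_lt_threshold (cov := cov) (before := before) (c := c)
    (p := p) (lt_of_le_of_lt hc'.1 hc'.2) (k - 1)
  refine ⟨insert c D, Finset.insert_subset hc hD, (Finset.card_insert_le _ _).trans (by omega),
    fun v hv => ?_⟩
  by_cases hcv : cov c v
  · exact ⟨c, Finset.mem_insert_self _ _, hcv⟩
  · obtain ⟨e, he, h⟩ := hcov v hv hcv (by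
      by_contra hlt
      exact absurd (h.trans (failTo_le_rank hv hcv hcv (not_lt.1 hlt)))
        (not_le.2 (rank_lt hirr hv)))
    exact ⟨e, Finset.mem_insert_of_mem he, h⟩

/-- One greedy choice is at least as good as the removal of a suitable member `b` from a cover `T`
without alternations: no two members `b` and `d` of `T` alternate as `b`, `d`, `b` along the order
by rank. The member `b` whose first failure comes last works. If it were still needed for a voter
`v` beyond its first failure `x`, then a member `d` that covers `x` would fail on some `y` no
later than `x`, and `y`, `x`, `v` would be an alternation of `b`, `d`, `b`. Since voters of equal
rank count as an alternation in either order, the sets of members of `T` that cover them are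
nested; this settles the case that `b` fails on `y` too, when `y` ties with `x`. -/
theorem exists_erase_cover {W : ℕ → Prop} {rk φ : ℕ → ℕ} {T : Finset ℕ} (hT : T.Nonempty)
    (hrk : ∀ v, W v → v < n ∧ rk v < n)
    (haba : ∀ b ∈ T, ∀ d ∈ T, ∀ y x v, W y → W x → W v → rk y ≤ rk x → rk x ≤ rk v →
      cov b y → ¬ cov d y → cov d x → ¬ cov b x → cov b v → ¬ cov d v → False)
    (hφ : ∀ e v, W v → τ ≤ rk v → ¬ cov e v → φ e ≤ rk v)
    (hφ' : ∀ e, φ e < n → ∃ v, W v ∧ τ ≤ rk v ∧ ¬ cov e v ∧ rk v = φ e)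
    (hcov : ∀ v, W v → τ ≤ rk v → ∃ e ∈ T, cov e v) :
    ∃ b ∈ T, ∀ v, W v → φ b ≤ rk v → ∃ e ∈ T.erase b, cov e v := by
  classical
  obtain ⟨b, hb, hmax⟩ := T.exists_max_image φ hT
  refine ⟨b, hb, fun v hv hbv => ?_⟩
  by_contra! hcon
  have hbn : φ b < n := hbv.trans_lt (hrk v hv).2
  obtain ⟨x0, hx0W, hx0τ, hx0b, hx0⟩ := hφ' b hbn
  -- Among the voters of least rank that `b` fails to cover, take one with the fewest covers.
  obtain ⟨x, hx, hmin⟩ := Finset.exists_min_image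
    ((Finset.range n).filter fun x => W x ∧ ¬ cov b x ∧ rk x = φ b)
    (fun x => (T.filter fun e => cov e x).card)
    ⟨x0, Finset.mem_filter.2 ⟨Finset.mem_range.2 (hrk x0 hx0W).1, hx0W, hx0b, hx0⟩⟩
  obtain ⟨-, hxW, hxb, hxφ⟩ := Finset.mem_filter.1 hx
  have only : ∀ e ∈ T, cov e v → e = b := fun e he hev => by
    by_contra hne
    exact hcon e (Finset.mem_erase.2 ⟨hne, he⟩) hev
  have hvb : cov b v := by
    obtain ⟨e, he, hev⟩ := hcov v hv (by omega)
    exact only e he hev ▸ hev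
  obtain ⟨d, hd, hdx⟩ := hcov x hxW (by omega)
  have hdb : d ≠ b := by rintro rfl; exact hxb hdx
  have hdv : ¬ cov d v := fun h => hdb (only d hd h)
  obtain ⟨y, hyW, hyτ, hdy, hy⟩ := hφ' d ((hmax d hd).trans_lt hbn)
  have hyx : rk y ≤ rk x := by rw [hy, hxφ]; exact hmax d hd
  by_cases hby : cov b y
  · exact haba b hb d hd y x v hyW hxW hv hyx (by omega) hby hdy hdx hxb hvb hdv
  · have hyb := hφ b y hyW hyτ hby
    have hlt : (T.filter fun e => cov e y).card < (T.filter fun e => cov e x).card := by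
      refine Finset.card_lt_card (Finset.ssubset_iff_of_subset ?_ |>.2 ⟨d, ?_, ?_⟩)
      · intro e he
        rw [Finset.mem_filter] at he ⊢
        refine ⟨he.1, ?_⟩
        by_contra hex
        exact haba e he.1 d hd y x y hyW hxW hyW (by omega) (by omega) he.2 hdy hdx hex he.2 hdy
      · exact Finset.mem_filter.2 ⟨hd, hdx⟩
      · exact fun h => hdy (Finset.mem_filter.1 h).2
    exact absurd (hmin y (Finset.mem_filter.2
      ⟨Finset.mem_range.2 (hrk y hyW).1, hyW, hby, by omega⟩)) (not_le.2 hlt)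

/-- Completeness of the greedy choice for covers without alternations. -/
theorem accepts_of_cover {k : ℕ} {T : Finset ℕ} (hirr : ∀ v, ¬ before p v v)
    (hc : c ∈ Finset.Ico n N) (hT : T ⊆ Finset.Ico n N) (hcard : T.card ≤ k - 1)
    (haba : ∀ b ∈ T, ∀ d ∈ T, ∀ y < n, ∀ x < n, ∀ v < n, ¬ cov c y → ¬ cov c x → ¬ cov c v →
      rank n cov before c p y ≤ rank n cov before c p x →
      rank n cov before c p x ≤ rank n cov before c p v →
      cov b y → ¬ cov d y → cov d x → ¬ cov b x → cov b v → ¬ cov d v → False)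
    (hcov : ∀ v < n, ¬ cov c v → ∃ e ∈ T, cov e v) :
    Accepts n N k cov before c p := by
  -- After `j` choices, `j` members of `T` have become dispensable.
  have key : ∀ j, ∃ T' ⊆ T, T'.card ≤ T.card - j ∧ ∀ v < n, ¬ cov c v →
      threshold n N cov before c p j ≤ rank n cov before c p v → ∃ e ∈ T', cov e v := by
    intro j
    induction j with
    | zero => exact ⟨T, subset_rfl, by simp, fun v hv hcv _ => hcov v hv hcv⟩
    | succ j ih =>
      obtain ⟨T', hT', hcard', hcov'⟩ := ih
      have le_round : ∀ e ∈ Finset.Ico n N,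
          failTo n cov before c p e (threshold n N cov before c p j) n ≤
            threshold n N cov before c p (j + 1) := fun e he =>
        Finset.le_sup (f := fun e =>
          failTo n cov before c p e (threshold n N cov before c p j) n) he
      rcases T'.eq_empty_or_nonempty with rfl | hne
      · refine ⟨∅, by simp, by simp, fun v hv hcv hle => ?_⟩
        have hlt := ((le_round c hc).trans hle).trans_lt (rank_lt hirr hv)
        obtain ⟨x, hx, hcx, -, hτ, -⟩ := exists_rank_eq_failTo hlt
        exact absurd (hcov' x hx hcx hτ) (by simp)
      · obtain ⟨b, hb, h⟩ := exists_erase_cover (cov := cov) (n := n)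
          (τ := threshold n N cov before c p j)
          (W := fun v => v < n ∧ ¬ cov c v) (rk := rank n cov before c p)
          (φ := fun e => failTo n cov before c p e (threshold n N cov before c p j) n) hne
          (fun v hv => ⟨hv.1, rank_lt hirr hv.1⟩)
          (fun b hb d hd y x v hy hx hv => haba b (hT' hb) d (hT' hd) y hy.1 x hx.1 v hv.1
            hy.2 hx.2 hv.2)
          (fun e v hv hτ he => failTo_le_rank hv.1 hv.2 he hτ)
          (fun e he => by
            obtain ⟨v, hv, h1, h2, h3, h4⟩ := exists_rank_eq_failTo he
            exact ⟨v, ⟨hv, h1⟩, h3, h2, h4⟩)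
          (fun v hv hτ => hcov' v hv.1 hv.2 hτ)
        refine ⟨T'.erase b, (Finset.erase_subset _ _).trans hT', ?_, fun v hv hcv hle => ?_⟩
        · rw [Finset.card_erase_of_mem hb]; omega
        · exact h v ⟨hv, hcv⟩ ((le_round b (hT (hT' hb))).trans hle)
  obtain ⟨T', -, hcard', hcov'⟩ := key (k - 1)
  obtain rfl : T' = ∅ := Finset.card_eq_zero.1 (by omega)
  rw [Accepts]
  by_contra hlt
  obtain ⟨v, hv, h1, -, h3, -⟩ := exists_rank_eq_failTo (not_le.1 hlt)
  simpa using hcov' v hv h1 h3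

end Greedy

/-! ### Discs of equal radii -/

section Geometry

/-- Open discs are convex: a convex combination of three points, one of which is the origin. -/
theorem sq_dist_comb_lt {r a₁ a₂ x₁ x₂ z₁ z₂ α β : ℝ} (hα : 0 ≤ α) (hβ : 0 ≤ β)
    (hαβ : α + β ≤ 1) (h0 : a₁ ^ 2 + a₂ ^ 2 < r)
    (hx : (x₁ - a₁) ^ 2 + (x₂ - a₂) ^ 2 < r) (hz : (z₁ - a₁) ^ 2 + (z₂ - a₂) ^ 2 < r) :
    (α * x₁ + β * z₁ - a₁) ^ 2 + (α * x₂ + β * z₂ - a₂) ^ 2 < r := by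
  have hγ : 0 ≤ 1 - α - β := by linarith
  have id : α * ((x₁ - a₁) ^ 2 + (x₂ - a₂) ^ 2) + β * ((z₁ - a₁) ^ 2 + (z₂ - a₂) ^ 2) +
      (1 - α - β) * (a₁ ^ 2 + a₂ ^ 2) -
      ((α * x₁ + β * z₁ - a₁) ^ 2 + (α * x₂ + β * z₂ - a₂) ^ 2) =
      α * β * ((x₁ - z₁) ^ 2 + (x₂ - z₂) ^ 2) + α * (1 - α - β) * (x₁ ^ 2 + x₂ ^ 2) +
      β * (1 - α - β) * (z₁ ^ 2 + z₂ ^ 2) := by ring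
  have nonneg : 0 ≤ α * β * ((x₁ - z₁) ^ 2 + (x₂ - z₂) ^ 2) +
      α * (1 - α - β) * (x₁ ^ 2 + x₂ ^ 2) + β * (1 - α - β) * (z₁ ^ 2 + z₂ ^ 2) := by positivity
  have h1 := mul_nonneg hα (sub_nonneg.2 hx.le)
  have h2 := mul_nonneg hβ (sub_nonneg.2 hz.le)
  have h3 := mul_nonneg hγ (sub_nonneg.2 h0.le)
  rcases hα.eq_or_lt with rfl | hα'
  · rcases hβ.eq_or_lt with rfl | hβ'
    · simpa using h0
    · have := mul_pos hβ' (sub_pos.2 hz)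
      linarith
  · have := mul_pos hα' (sub_pos.2 hx)
    linarith

/-- Open discs are convex: a convex combination of two points. -/
theorem sq_dist_seg_lt {r a₁ a₂ x₁ x₂ z₁ z₂ μ : ℝ} (hμ : 0 ≤ μ) (hμ' : μ ≤ 1)
    (hx : (x₁ - a₁) ^ 2 + (x₂ - a₂) ^ 2 < r) (hz : (z₁ - a₁) ^ 2 + (z₂ - a₂) ^ 2 < r) :
    (x₁ + μ * (z₁ - x₁) - a₁) ^ 2 + (x₂ + μ * (z₂ - x₂) - a₂) ^ 2 < r := by
  have := sq_dist_comb_lt (r := r) (a₁ := a₁ - x₁) (a₂ := a₂ - x₂) (x₁ := z₁ - x₁)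
    (x₂ := z₂ - x₂) (z₁ := 0) (z₂ := 0) (α := μ) (β := 0) hμ le_rfl (by linarith)
    (by linarith) (by linarith) (by linarith)
  linarith

/-- An affine function with values of opposite signs at the ends of a segment has a zero on it. -/
theorem exists_zero_of_mul_nonpos {u v : ℝ} (h : u * v ≤ 0) :
    ∃ l : ℝ, 0 ≤ l ∧ l ≤ 1 ∧ u + l * (v - u) = 0 := by
  rcases eq_or_ne u v with rfl | huv
  · exact ⟨0, le_rfl, zero_le_one, by nlinarith⟩
  · have h' : u - v ≠ 0 := sub_ne_zero.2 huv
    have hpos : 0 < (u - v) ^ 2 := by positivity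
    have e : u / (u - v) = u * (u - v) / (u - v) ^ 2 := by field_simp
    refine ⟨u / (u - v), ?_, ?_, by field_simp; ring⟩
    · rw [e]
      exact div_nonneg (by nlinarith [mul_self_nonneg u]) hpos.le
    · rw [e, div_le_one hpos]
      nlinarith [mul_self_nonneg v]

theorem exists_mul_of_collinear {w₁ w₂ a₁ a₂ : ℝ} (h : w₁ * a₂ = w₂ * a₁)
    (ha : a₁ = 0 → a₂ ≠ 0) : ∃ m : ℝ, w₁ = m * a₁ ∧ w₂ = m * a₂ := by
  rcases eq_or_ne a₁ 0 with h1 | h1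
  · have h2 := ha h1
    rw [h1, mul_zero] at h
    refine ⟨w₂ / a₂, ?_, by field_simp⟩
    rw [h1, mul_zero]
    exact (mul_eq_zero.1 h).resolve_right h2
  · exact ⟨w₁ / a₁, by field_simp, by field_simp; linarith⟩

/-- Let `x` and `z` lie in the disc about `e` and not in the disc about `b`, let `q` lie in the
disc about `b` and not in the one about `e`, and let the segment from `x` to `z` meet the disc about
`b`. Then `b` and `q` are strictly on the same side of the line through `x` and `z`. Otherwise the
segment from `b` to `q` meets this line within the disc about `b`, hence between `x` and `z`; but
the bisector of `b` and `e` separates `b` and `q` from `x` and `z`. -/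
theorem same_side {r b₁ b₂ e₁ e₂ q₁ q₂ x₁ x₂ z₁ z₂ σ : ℝ}
    (hqb : (q₁ - b₁) ^ 2 + (q₂ - b₂) ^ 2 < r) (hqe : r ≤ (q₁ - e₁) ^ 2 + (q₂ - e₂) ^ 2)
    (hxb : r ≤ (x₁ - b₁) ^ 2 + (x₂ - b₂) ^ 2) (hxe : (x₁ - e₁) ^ 2 + (x₂ - e₂) ^ 2 < r)
    (hzb : r ≤ (z₁ - b₁) ^ 2 + (z₂ - b₂) ^ 2) (hze : (z₁ - e₁) ^ 2 + (z₂ - e₂) ^ 2 < r)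
    (hσ : 0 ≤ σ) (hσ' : σ ≤ 1)
    (hm : (x₁ + σ * (z₁ - x₁) - b₁) ^ 2 + (x₂ + σ * (z₂ - x₂) - b₂) ^ 2 < r) :
    0 < ((b₁ - x₁) * (z₂ - x₂) - (b₂ - x₂) * (z₁ - x₁)) *
      ((q₁ - x₁) * (z₂ - x₂) - (q₂ - x₂) * (z₁ - x₁)) := by
  by_contra hneg
  set u := (b₁ - x₁) * (z₂ - x₂) - (b₂ - x₂) * (z₁ - x₁) with hu
  set v := (q₁ - x₁) * (z₂ - x₂) - (q₂ - x₂) * (z₁ - x₁) with hv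
  have hr : 0 < r := lt_of_le_of_lt (by positivity) hqb
  obtain ⟨l, hl0, hl1, hl⟩ := exists_zero_of_mul_nonpos (not_lt.1 hneg)
  obtain ⟨m, hm1, hm2⟩ : ∃ m : ℝ, b₁ + l * (q₁ - b₁) - x₁ = m * (z₁ - x₁) ∧
      b₂ + l * (q₂ - b₂) - x₂ = m * (z₂ - x₂) := by
    refine exists_mul_of_collinear (by rw [hu, hv] at hl; linarith) ?_
    by_contra! h
    rw [h.1, h.2] at hm
    simp only [mul_zero, add_zero] at hm
    linarith
  replace hm1 : b₁ + l * (q₁ - b₁) = x₁ + m * (z₁ - x₁) := by linarith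
  replace hm2 : b₂ + l * (q₂ - b₂) = x₂ + m * (z₂ - x₂) := by linarith
  clear_value u v
  have hw : (x₁ + m * (z₁ - x₁) - b₁) ^ 2 + (x₂ + m * (z₂ - x₂) - b₂) ^ 2 < r := by
    rw [← hm1, ← hm2]
    exact sq_dist_seg_lt hl0 hl1 (by simpa using hr) hqb
  -- A point of the line in the disc lies between `x` and `z`.
  have hm0 : 0 < m := by
    by_contra hm0
    rw [not_lt] at hm0
    rcases hσ.eq_or_lt with rfl | hσ0
    · simp only [zero_mul, add_zero] at hm
      linarith
    · have hne : σ - m ≠ 0 := by linarith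
      have := sq_dist_seg_lt (μ := -m / (σ - m)) (div_nonneg (by linarith) (by linarith))
        ((div_le_one (by linarith)).2 (by linarith)) hw hm
      have e : ∀ x z : ℝ, x + m * (z - x) + -m / (σ - m) * (x + σ * (z - x) -
          (x + m * (z - x))) = x := fun x z => by field_simp; ring
      rw [e, e] at this
      linarith
  have hm1' : m < 1 := by
    by_contra hm1'
    rw [not_lt] at hm1'
    rcases hσ'.eq_or_lt with rfl | hσ1
    · simp only [one_mul, add_sub_cancel] at hm
      linarith
    · have hne : m - σ ≠ 0 := by linarith
      have := sq_dist_seg_lt (μ := (1 - σ) / (m - σ)) (div_nonneg (by linarith) (by linarith))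
        ((div_le_one (by linarith)).2 (by linarith)) hm hw
      have e : ∀ x z : ℝ, x + σ * (z - x) + (1 - σ) / (m - σ) * (x + m * (z - x) -
          (x + σ * (z - x))) = z := fun x z => by field_simp; ring
      rw [e, e] at this
      linarith
  -- The difference of the squared distances to `e` and to `b` is affine.
  set G : ℝ → ℝ → ℝ := fun y₁ y₂ =>
    (y₁ - e₁) ^ 2 + (y₂ - e₂) ^ 2 - ((y₁ - b₁) ^ 2 + (y₂ - b₂) ^ 2) with hG
  have hGx : G x₁ x₂ < 0 := by simp only [hG]; linarith
  have hGz : G z₁ z₂ < 0 := by simp only [hG]; linarith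
  have hGq : 0 < G q₁ q₂ := by simp only [hG]; linarith
  have hGb : 0 ≤ G b₁ b₂ := by
    have : G b₁ b₂ = (b₁ - e₁) ^ 2 + (b₂ - e₂) ^ 2 := by simp only [hG]; ring
    rw [this]
    positivity
  have aff : ∀ (y₁ y₂ w₁ w₂ μ : ℝ), G (y₁ + μ * (w₁ - y₁)) (y₂ + μ * (w₂ - y₂)) =
      (1 - μ) * G y₁ y₂ + μ * G w₁ w₂ := by
    intro y₁ y₂ w₁ w₂ μ
    simp only [hG]
    ring
  have h1 := aff x₁ x₂ z₁ z₂ m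
  have h2 := aff b₁ b₂ q₁ q₂ l
  rw [hm1, hm2, h1] at h2
  have h3 := mul_pos hm0 (neg_pos.2 hGz)
  have h4 := mul_pos (sub_pos.2 hm1') (neg_pos.2 hGx)
  have h5 := mul_nonneg hl0 hGq.le
  have h6 := mul_nonneg (sub_nonneg.2 hl1) hGb
  linarith

/-- The geometric heart of the matter: seen from the origin, which lies in the discs about `b` and
`d` but not in the one about `c`, the complements of the discs about `b` and `d` do not alternate
as `b`, `d`, `b` on points `x`, `y`, `z` of the disc about `c`. The line through `x` and `z` would
have the origin and `y` on opposite sides, but both on the side of `b`. -/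
theorem no_alternation {r b₁ b₂ d₁ d₂ c₁ c₂ x₁ x₂ y₁ y₂ z₁ z₂ α β : ℝ}
    (hb : b₁ ^ 2 + b₂ ^ 2 < r) (hd : d₁ ^ 2 + d₂ ^ 2 < r) (hc : r ≤ c₁ ^ 2 + c₂ ^ 2)
    (hxc : (x₁ - c₁) ^ 2 + (x₂ - c₂) ^ 2 < r) (hzc : (z₁ - c₁) ^ 2 + (z₂ - c₂) ^ 2 < r)
    (hxb : r ≤ (x₁ - b₁) ^ 2 + (x₂ - b₂) ^ 2) (hzb : r ≤ (z₁ - b₁) ^ 2 + (z₂ - b₂) ^ 2)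
    (hyb : (y₁ - b₁) ^ 2 + (y₂ - b₂) ^ 2 < r) (hyd : r ≤ (y₁ - d₁) ^ 2 + (y₂ - d₂) ^ 2)
    (hxd : (x₁ - d₁) ^ 2 + (x₂ - d₂) ^ 2 < r) (hzd : (z₁ - d₁) ^ 2 + (z₂ - d₂) ^ 2 < r)
    (hα : 0 ≤ α) (hβ : 0 ≤ β) (hy₁ : y₁ = α * x₁ + β * z₁) (hy₂ : y₂ = α * x₂ + β * z₂) :
    False := by
  have hs : 1 < α + β := by
    by_contra hs
    have := sq_dist_comb_lt hα hβ (not_lt.1 hs) hd hxd hzd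
    rw [← hy₁, ← hy₂] at this
    linarith
  have hs0 : 0 < α + β := by linarith
  have hne : α + β ≠ 0 := hs0.ne'
  have hb' : (0 - b₁) ^ 2 + (0 - b₂) ^ 2 < r := by simpa using hb
  have hm := sq_dist_seg_lt (μ := 1 / (α + β)) (by positivity)
    ((div_le_one hs0).2 hs.le) hb' hyb
  have e : ∀ x y z : ℝ, y = α * x + β * z →
      0 + 1 / (α + β) * (y - 0) = x + β / (α + β) * (z - x) := by
    rintro x _ z rfl
    field_simp
    ring
  rw [e x₁ y₁ z₁ hy₁, e x₂ y₂ z₂ hy₂] at hm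
  have hβ1 : β / (α + β) ≤ 1 := (div_le_one hs0).2 (by linarith)
  have h1 := same_side hb' (by simpa using hc) hxb hxc hzb hzc (by positivity) hβ1 hm
  have h2 := same_side hyb hyd hxb hxd hzb hzd (by positivity) hβ1 hm
  set u := (b₁ - x₁) * (z₂ - x₂) - (b₂ - x₂) * (z₁ - x₁)
  set v := (0 - x₁) * (z₂ - x₂) - (0 - x₂) * (z₁ - x₁) with hv
  have hyv : (y₁ - x₁) * (z₂ - x₂) - (y₂ - x₂) * (z₁ - x₁) = -(α + β - 1) * v := by
    rw [hv, hy₁, hy₂]; ring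
  rw [hyv] at h2
  have := mul_pos (sub_pos.2 hs) h1
  linarith

end Geometry

/-! ### The order of the voters around a point -/

section Order

variable {ρ : ℕ → ℝ} {c p : ℕ}

theorem leftTurn_irrefl (o a : ℕ) : ¬ leftTurn ρ o a a := by
  rw [leftTurn, mul_comm]
  exact lt_irrefl _

theorem not_far_iff {a b : ℕ} : ¬ far ρ a b ↔
    (ρ (2 * a + 1) - ρ (2 * b + 1)) ^ 2 + (ρ (2 * a + 2) - ρ (2 * b + 2)) ^ 2 < ρ 0 * ρ 0 := by
  rw [far, not_le]
  ring_nf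

/-- The inner product of the vectors from `p` to `c` and from `p` to `v`. -/
def forward (ρ : ℕ → ℝ) (c p v : ℕ) : ℝ :=
  (ρ (2 * c + 1) - ρ (2 * p + 1)) * (ρ (2 * v + 1) - ρ (2 * p + 1)) +
    (ρ (2 * c + 2) - ρ (2 * p + 2)) * (ρ (2 * v + 2) - ρ (2 * p + 2))

/-- The cross product of the vectors from `p` to `u` and from `p` to `v`. -/
def cross (ρ : ℕ → ℝ) (p u v : ℕ) : ℝ :=
  (ρ (2 * u + 1) - ρ (2 * p + 1)) * (ρ (2 * v + 2) - ρ (2 * p + 2)) -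
    (ρ (2 * u + 2) - ρ (2 * p + 2)) * (ρ (2 * v + 1) - ρ (2 * p + 1))

theorem leftTurn_iff {u v : ℕ} : leftTurn ρ p u v ↔ 0 < cross ρ p u v := by
  rw [leftTurn, cross, sub_pos]

/-- A disc lies in an open half-plane as seen from a point outside. -/
theorem forward_pos (hp : far ρ c p) {v : ℕ} (hv : ¬ far ρ c v) : 0 < forward ρ c p v := by
  rw [not_far_iff] at hv
  have hp : ρ 0 * ρ 0 ≤ (ρ (2 * c + 1) - ρ (2 * p + 1)) ^ 2 +
      (ρ (2 * c + 2) - ρ (2 * p + 2)) ^ 2 := not_lt.1 fun h => (not_far_iff.2 h) hp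
  rw [forward]
  nlinarith [sq_nonneg (ρ (2 * v + 1) - ρ (2 * p + 1)), sq_nonneg (ρ (2 * v + 2) - ρ (2 * p + 2))]

theorem forward_mul_cross (u v w : ℕ) : forward ρ c p v * cross ρ p u w =
    forward ρ c p w * cross ρ p u v + forward ρ c p u * cross ρ p v w := by
  simp only [forward, cross]
  ring

/-- Within the half-plane the cross product orders the voters by angle; the rank respects this
order. -/
theorem cross_nonneg_of_rank_le {n u v : ℕ} (hp : far ρ c p) (hvn : v < n)
    (hu : ¬ far ρ c u) (hv : ¬ far ρ c v)
    (h : rank n (far ρ) (leftTurn ρ) c p u ≤ rank n (far ρ) (leftTurn ρ) c p v) :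
    0 ≤ cross ρ p u v := by
  classical
  by_contra hneg
  have hvu : 0 < cross ρ p v u := by
    have : cross ρ p v u = -cross ρ p u v := by simp only [cross]; ring
    linarith
  refine absurd h (not_le.2 ?_)
  rw [rank, rank, Nat.count_eq_card_filter_range, Nat.count_eq_card_filter_range]
  refine Finset.card_lt_card ((Finset.ssubset_iff_of_subset ?_).2 ⟨v, ?_, ?_⟩)
  · intro w hw
    simp only [Finset.mem_filter, Finset.mem_range, leftTurn_iff] at hw ⊢
    refine ⟨hw.1, hw.2.1, ?_⟩
    have h1 := mul_pos (forward_pos hp hu) hw.2.2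
    have h2 := mul_pos (forward_pos hp hw.2.1) hvu
    have h3 := forward_mul_cross (ρ := ρ) (c := c) (p := p) w v u
    exact pos_of_mul_pos_right (by linarith : 0 < forward ρ c p v * cross ρ p w u)
      (forward_pos hp hv).le
  · simp [hvn, hv, leftTurn_iff, hvu]
  · simp [leftTurn_irrefl]

/-- A vector between two others in angular order is a nonnegative combination of them. -/
theorem exists_comb {y x v : ℕ} (hy : 0 < forward ρ c p y) (hx : 0 < forward ρ c p x)
    (hv : 0 < forward ρ c p v) (hyx : 0 ≤ cross ρ p y x) (hxv : 0 ≤ cross ρ p x v) :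
    ∃ α β : ℝ, 0 ≤ α ∧ 0 ≤ β ∧
      ρ (2 * x + 1) - ρ (2 * p + 1) =
        α * (ρ (2 * y + 1) - ρ (2 * p + 1)) + β * (ρ (2 * v + 1) - ρ (2 * p + 1)) ∧
      ρ (2 * x + 2) - ρ (2 * p + 2) =
        α * (ρ (2 * y + 2) - ρ (2 * p + 2)) + β * (ρ (2 * v + 2) - ρ (2 * p + 2)) := by
  have id := forward_mul_cross (ρ := ρ) (c := c) (p := p) y x v
  have h1 := mul_nonneg hv.le hyx
  have h2 := mul_nonneg hy.le hxv
  have hyv : 0 ≤ cross ρ p y v :=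
    nonneg_of_mul_nonneg_right (by linarith : 0 ≤ forward ρ c p x * cross ρ p y v) hx
  rcases hyv.eq_or_lt with h0 | hpos
  · -- All three vectors have the same direction.
    rw [← h0, mul_zero] at id
    have hyx0 : cross ρ p y x = 0 :=
      (mul_eq_zero.1 (by linarith : forward ρ c p v * cross ρ p y x = 0)).resolve_left hv.ne'
    refine ⟨forward ρ c p x / forward ρ c p y, 0, by positivity, le_rfl, ?_, ?_⟩
    · rw [zero_mul, add_zero, div_mul_eq_mul_div, eq_div_iff hy.ne']
      simp only [forward, cross] at hyx0 ⊢
      linear_combination (ρ (2 * c + 2) - ρ (2 * p + 2)) * (-hyx0)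
    · rw [zero_mul, add_zero, div_mul_eq_mul_div, eq_div_iff hy.ne']
      simp only [forward, cross] at hyx0 ⊢
      linear_combination (ρ (2 * c + 1) - ρ (2 * p + 1)) * hyx0
  · refine ⟨cross ρ p x v / cross ρ p y v, cross ρ p y x / cross ρ p y v, by positivity,
      by positivity, ?_, ?_⟩
    all_goals
      rw [div_mul_eq_mul_div, div_mul_eq_mul_div, ← add_div, eq_div_iff hpos.ne']
      simp only [cross]
      ring

/-- `no_alternation` for the voters not covered by `c`, ordered by rank around `p`. -/
theorem far_no_alternation {n b d y x v : ℕ} (hp : far ρ c p) (hbp : ¬ far ρ b p)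
    (hdp : ¬ far ρ d p) (hxn : x < n) (hvn : v < n)
    (hcy : ¬ far ρ c y) (hcx : ¬ far ρ c x) (hcv : ¬ far ρ c v)
    (hyx : rank n (far ρ) (leftTurn ρ) c p y ≤ rank n (far ρ) (leftTurn ρ) c p x)
    (hxv : rank n (far ρ) (leftTurn ρ) c p x ≤ rank n (far ρ) (leftTurn ρ) c p v)
    (hby : far ρ b y) (hdy : ¬ far ρ d y) (hdx : far ρ d x) (hbx : ¬ far ρ b x)
    (hbv : far ρ b v) (hdv : ¬ far ρ d v) : False := by
  obtain ⟨α, β, hα, hβ, e1, e2⟩ := exists_comb (forward_pos hp hcy) (forward_pos hp hcx)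
    (forward_pos hp hcv) (cross_nonneg_of_rank_le hp hxn hcy hcx hyx)
    (cross_nonneg_of_rank_le hp hvn hcx hcv hxv)
  have near : ∀ {a z}, ¬ far ρ a z → (ρ (2 * z + 1) - ρ (2 * p + 1) -
      (ρ (2 * a + 1) - ρ (2 * p + 1))) ^ 2 + (ρ (2 * z + 2) - ρ (2 * p + 2) -
      (ρ (2 * a + 2) - ρ (2 * p + 2))) ^ 2 < ρ 0 * ρ 0 := by
    intro a z h
    rw [not_far_iff] at h
    linarith
  have away : ∀ {a z}, far ρ a z → ρ 0 * ρ 0 ≤ (ρ (2 * z + 1) - ρ (2 * p + 1) -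
      (ρ (2 * a + 1) - ρ (2 * p + 1))) ^ 2 + (ρ (2 * z + 2) - ρ (2 * p + 2) -
      (ρ (2 * a + 2) - ρ (2 * p + 2))) ^ 2 := by
    intro a z h
    rw [far] at h
    linarith
  exact no_alternation (not_far_iff.1 hbp) (not_far_iff.1 hdp)
    (not_lt.1 fun h => not_far_iff.2 h hp) (near hcy) (near hcv) (away hby) (away hbv) (near hbx)
    (away hdx) (near hdy) (near hdv) hα hβ e1 e2

end Order

/-! ### Instances in the plane -/

theorem le_lamDist_one_iff {X : Type*} [MetricSpace X] {x : X} {S : Finset X} {t : ℝ}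
    (ht : 0 < t) : t ≤ lamDist 1 x S ↔ ∃ c ∈ S, t ≤ dist x c := by
  have hsorted := Multiset.pairwise_sort (S.val.map fun c => dist x c) (fun a b : ℝ => b ≤ a)
  have hmem : ∀ d, d ∈ (S.val.map fun c => dist x c).sort (fun a b : ℝ => b ≤ a) ↔
      ∃ c ∈ S, dist x c = d := fun d => by
    rw [Multiset.mem_sort, Multiset.mem_map]
    rfl
  rw [lamDist]
  generalize (S.val.map fun c => dist x c).sort (fun a b : ℝ => b ≤ a) = l at hsorted hmem
  cases l with
  | nil =>
    -- The value at the empty committee is zero, which is less than `t`.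
    refine iff_of_false (by simpa using ht) ?_
    rintro ⟨c, hc, -⟩
    simpa using (hmem _).2 ⟨c, hc, rfl⟩
  | cons a l =>
    simp only [Nat.sub_self, List.getD_cons_zero]
    constructor
    · intro h
      obtain ⟨c, hc, rfl⟩ := (hmem a).1 List.mem_cons_self
      exact ⟨c, hc, h⟩
    · rintro ⟨c, hc, h⟩
      rcases List.mem_cons.1 ((hmem _).2 ⟨c, hc, rfl⟩) with h' | h'
      · exact h.trans h'.le
      · exact h.trans (List.rel_of_pairwise_cons hsorted h')

theorem getD_flatMap_pair {α : Type*} (f g : α → ℝ) (l : List α) {i : ℕ} (hi : i < l.length) :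
    (l.flatMap fun x => [f x, g x]).getD (2 * i) 0 = f l[i] ∧
      (l.flatMap fun x => [f x, g x]).getD (2 * i + 1) 0 = g l[i] := by
  induction l generalizing i with
  | nil => simp at hi
  | cons a l ih =>
    cases i with
    | zero => simp
    | succ i =>
      have := ih (i := i) (by simpa using hi)
      simpa [Nat.mul_succ] using this

variable (I : PlaneInstance)

/-- The points of an instance in the order of their numbers: first the voters, then the
candidates. -/
def points : List (EuclideanSpace ℝ (Fin 2)) := I.voters ++ I.candidates

theorem points_length : (points I).length = I.voters.length + I.candidates.length :=
  List.length_append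

theorem far_encode_iff {a b : ℕ} (ha : a < (points I).length) (hb : b < (points I).length) :
    far I.encode.R a b ↔ I.t ≤ dist (points I)[b] (points I)[a] := by
  have h : ∀ {i : ℕ} (hi : i < (points I).length), I.encode.R (2 * i + 1) = (points I)[i] 0 ∧
      I.encode.R (2 * i + 2) = (points I)[i] 1 := fun {i} hi => by
    exact getD_flatMap_pair (fun x : EuclideanSpace ℝ (Fin 2) => x 0) (fun x => x 1) _ hi
  have h0 : I.encode.R 0 = I.t := rfl
  rw [far, (h ha).1, (h ha).2, (h hb).1, (h hb).2, h0, dist_comm, EuclideanSpace.dist_eq,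
    Real.le_sqrt' I.t_pos, Fin.sum_univ_two, Real.dist_eq, Real.dist_eq, sq_abs, sq_abs]
  ring_nf

theorem isYes_iff : I.IsYes ↔ I.k ≤ I.candidates.length ∧
    ∃ D ⊆ Finset.Ico I.voters.length (I.voters.length + I.candidates.length),
      D.card ≤ I.k ∧ ∀ v < I.voters.length, ∃ e ∈ D, far I.encode.R e v := by
  classical
  have hlen := points_length I
  have hC : I.C.card = I.candidates.length := rfl
  have hvoter : ∀ {v} (hv : v < I.voters.length), (points I)[v]'(by omega) = I.voters[v] :=
    fun hv => List.getElem_append_left hv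
  have hcand : ∀ {e} (h : I.voters.length ≤ e) (he : e < I.voters.length + I.candidates.length),
      (points I)[e]'(by omega) = I.candidates[e - I.voters.length]'(by omega) :=
    fun h he => List.getElem_append_right h
  have hyes : I.IsYes ↔ ∃ S ⊆ I.C, S.card = I.k ∧ ∀ v ∈ I.voters, ∃ c ∈ S, I.t ≤ dist v c := by
    simp only [PlaneInstance.IsYes, ObnoxiousEgalCC, ObnoxEgalMedianCS,
      le_lamDist_one_iff I.t_pos]
    rfl
  rw [hyes]
  constructor
  · rintro ⟨S, hS, hcard, hcov⟩
    refine ⟨by rw [← hC, ← hcard]; exact Finset.card_le_card hS, ?_⟩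
    -- The number of a candidate is the number of voters plus its position in the list.
    refine ⟨S.image fun c => I.voters.length + I.candidates.idxOf c, ?_,
      Finset.card_image_le.trans hcard.le, fun v hv => ?_⟩
    · intro e he
      obtain ⟨c, hc, rfl⟩ := Finset.mem_image.1 he
      have hc' : c ∈ I.candidates := hS hc
      have := List.idxOf_lt_length_iff.2 hc'
      exact Finset.mem_Ico.2 ⟨by omega, by omega⟩
    · obtain ⟨c, hc, h⟩ := hcov _ (List.getElem_mem hv)
      have hc' : c ∈ I.candidates := hS hc
      have hlt := List.idxOf_lt_length_iff.2 hc'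
      refine ⟨_, Finset.mem_image_of_mem _ hc, ?_⟩
      rw [far_encode_iff I (by omega) (by omega), hvoter hv, hcand (by omega) (by omega)]
      simpa using h
  · rintro ⟨hk, D, hD, hcard, hcov⟩
    let S := I.C.filter fun c => ∃ e, ∃ he : e < (points I).length, e ∈ D ∧ (points I)[e] = c
    have hScard : S.card ≤ I.k := by
      refine le_trans ?_ hcard
      refine Finset.card_le_card_of_surjOn (fun e => (points I).getD e 0) ?_
      intro c hc
      obtain ⟨-, e, he, heD, rfl⟩ := Finset.mem_filter.1 hc
      exact ⟨e, heD, List.getD_eq_getElem _ _ he⟩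
    obtain ⟨S', hSS', hS', hcard'⟩ :=
      Finset.exists_subsuperset_card_eq (Finset.filter_subset _ _) hScard (hk.trans hC.ge)
    refine ⟨S', hS', hcard', fun v hv => ?_⟩
    obtain ⟨i, hi, rfl⟩ := List.getElem_of_mem hv
    obtain ⟨e, heD, h⟩ := hcov i hi
    have he := Finset.mem_Ico.1 (hD heD)
    rw [far_encode_iff I (by omega) (by omega), hvoter hi] at h
    refine ⟨(points I)[e]'(by omega), hSS' (Finset.mem_filter.2 ⟨?_, e, by omega, heD, rfl⟩), h⟩
    rw [hcand he.1 he.2]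
    exact List.getElem_mem _

/-- The algorithm is correct. In a minimal cover, a member `c` and a voter `p` that only `c` covers
are a pair for which the greedy choice succeeds. -/
theorem exists_cover_iff_exists_accepts {n N k : ℕ} {ρ : ℕ → ℝ} (hk : 1 ≤ k) :
    (∃ D ⊆ Finset.Ico n N, D.card ≤ k ∧ ∀ v < n, ∃ e ∈ D, far ρ e v) ↔
      n = 0 ∨ ∃ c ∈ Finset.Ico n N, ∃ p < n, Accepts n N k (far ρ) (leftTurn ρ) c p := by
  classical
  constructor
  · rintro ⟨D, hD, hcard, hcov⟩
    rcases Nat.eq_zero_or_pos n with h0 | hn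
    · exact Or.inl h0
    right
    obtain ⟨D₀, hD₀, hmin⟩ := Finset.exists_min_image
      (D.powerset.filter fun D' => ∀ v < n, ∃ e ∈ D', far ρ e v) Finset.card
      ⟨D, Finset.mem_filter.2 ⟨Finset.mem_powerset_self D, hcov⟩⟩
    obtain ⟨hD₀D, hcov₀⟩ := Finset.mem_filter.1 hD₀
    rw [Finset.mem_powerset] at hD₀D
    obtain ⟨c, hc, -⟩ := hcov₀ 0 hn
    have hlt := Finset.card_erase_lt_of_mem hc
    obtain ⟨p, hpn, hp⟩ : ∃ p < n, ∀ e ∈ D₀.erase c, ¬ far ρ e p := by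
      by_contra! h
      exact absurd (hmin (D₀.erase c) (Finset.mem_filter.2
        ⟨Finset.mem_powerset.2 ((Finset.erase_subset _ _).trans hD₀D), h⟩)) (not_le.2 hlt)
    have hcp : far ρ c p := by
      obtain ⟨e, he, hep⟩ := hcov₀ p hpn
      by_cases hec : e = c
      · exact hec ▸ hep
      · exact absurd hep (hp e (Finset.mem_erase.2 ⟨hec, he⟩))
    refine ⟨c, hD (hD₀D hc), p, hpn, accepts_of_cover (T := D₀.erase c)
      (leftTurn_irrefl p) (hD (hD₀D hc)) (((Finset.erase_subset _ _).trans hD₀D).trans hD) ?_ ?_ ?_⟩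
    · have := Finset.card_le_card hD₀D
      omega
    · intro b hb d hd y _ x hx v hv hcy hcx hcv
      exact far_no_alternation hcp (hp b hb) (hp d hd) hx hv hcy hcx hcv
    · intro v hv hcv
      obtain ⟨e, he, hev⟩ := hcov₀ v hv
      exact ⟨e, Finset.mem_erase.2 ⟨fun h => hcv (h ▸ hev), he⟩, hev⟩
  · rintro (rfl | ⟨c, hc, p, -, h⟩)
    · exact ⟨∅, by simp, by simp, by simp⟩
    · exact h.exists_cover hk (leftTurn_irrefl p) hc

end RealRAM

theorem mainTheorem3 :
    RealRAM.DecidesInPolyTime PlaneInstance.encode PlaneInstance.numPoints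
      PlaneInstance.IsYes := by
  classical
  refine RealRAM.decidesInPolyTime_of_run RealRAM.mainProg RealRAM.timePoly ?_ (fun I => ?_)
    fun I => ?_
  · simp only [RealRAM.timePoly_eval]
    exact RealRAM.mainTime_mono
  · exact ⟨_, _, _, fun _ => rfl⟩
  · have h := RealRAM.run_mainProg (s := I.encode) (n := I.voters.length)
      (m := I.candidates.length) (k := I.k) I.k_pos (fun _ => rfl) rfl
    rw [RealRAM.timePoly_eval]
    refine h.mono le_rfl fun s' hs' => ?_
    have hyes := RealRAM.isYes_iff I
    rw [RealRAM.exists_cover_iff_exists_accepts I.k_pos] at hyes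
    rw [hs', hyes]
    exact ⟨fun h => if_pos h, fun h => if_neg h⟩
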